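/- **Setting.** Let $d\in\{1,2,3\}$, let $\Omega\subset\mathbb R^d$ be a bounded domain with Lipschitz boundary, $0<T<\infty$, $Q=\Omega\times(0,T)$, $\Sigma=\partial\Omega\times(0,T)$, $\Sigma_0=\Omega\times\{0\}$, $\Sigma_T=\Omega\times\{T\}$. Write $(\cdot,\cdot)_U$ and $\|\cdot\|_U$ for the inner product and norm of $L_2(U)$; derivatives are weak derivatives and boundary values are traces. Let $V^{1,0}_0=\{u\in L_2(Q):\nabla_xu\in L_2(Q)^d,\ u|_\Sigma=0\}$, $V^1_{0,\underline 0}=\{u\in V^{1,0}_0:\partial_tu\in L_2(Q),\ u|_{\Sigma_0}=0\}$ and $V^{\Delta_x,1}_{0,\underline 0}=\{u\in V^{1,0}_0:\Delta_xu,\partial_tu\in L_2(Q),\ u|_{\Sigma_0}=0\}$. Let $p\ge2$ and consider on the parameter domain $\hat Q=(0,1)^{d+1}$ a spline space of degree $p$ in every direction built on open knot vectors whose inner knots have multiplicity at most $p-1$: the tensor-product B-splines or NURBS, or the hierarchical (equivalently, truncated hierarchical) splines of a finite hierarchy of nested knot vectors and nested refinement regions, possibly divided by a positive weighting function $\sum_i\kappa_i\hat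 B_i$ of the coarsest level. Let $\hat{\mathcal K}_h$ be the corresponding mesh of open boxes. Let $\Phi$ be a NURBS map (on the knots of the coarsest level) that maps $\hat Q$ bijectively onto $Q$ and whose inverse is smooth on each closed element. Put $\mathcal K_h=\{\Phi(\hat K):\hat K\in\hat{\mathcal K}_h\}$, $h_K=\operatorname{diam}K$, let $V_h$ be the span of the functions $\hat\varphi\circ\Phi^{-1}$ with $\hat\varphi$ in the spline basis, and $$V_{0h}=V_h\cap V^1_{0,\underline 0},\qquad V_{0h,*}=V^1_{0,\underline 0}\cap V^{\Delta_x,1}_{0,\underline 0}+V_{0h}.$$ For $K\in\mathcal K_h$ let $C_K>0$ be a constant in the inverse inequality $\|\nabla_xv_h\|_K\le C_Kh_K^{-1}\|v_h\|_K$, $v_h\in V_h$, let $\theta_K>0$, and $\delta_K=\theta_Kh_K$. Define, for $u\in V_{0h,*}$ and $v_h\in V_{0h}$, $$a_{loc,h}(u,v_h)=(\partial_tu,v_h)_Q+(\nabla_xu,\nabla_xv_h)_Q+\sum_{K\in\mathcal K_h}\delta_K\Big((\partial_tu,\partial_tv_h)_K+(\nabla_xu,\nabla_x\partial_tv_h)_K-\langle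 \boldsymbol n_x^{\partial K}\cdot\nabla_xu,\partial_tv_h\rangle_{\partial K}\Big),$$ where $\langle\cdot,\cdot\rangle_{\partial K}$ is the duality product of $H^{-1/2}(\partial K)\times H^{1/2}(\partial K)$; the normal trace of a field $\boldsymbol y\in L_2(K)^d$ with $\operatorname{div}_x\boldsymbol y\in L_2(K)$ is the functional $\langle\boldsymbol n_x^{\partial K}\cdot\boldsymbol y,w\rangle_{\partial K}=(\boldsymbol y,\nabla_xw)_K+(\operatorname{div}_x\boldsymbol y,w)_K$, $w\in H^1(K)$. Finally let $$|||v|||_{loc,h}^2=\|\nabla_xv\|_Q^2+\tfrac12\|v\|_{\Sigma_T}^2+\sum_{K\in\mathcal K_h}\delta_K\|\partial_tv\|_K^2,\qquad |||v|||_{loc,h,*}^2=|||v|||_{loc,h}^2+\sum_{K\in\mathcal K_h}\big(\delta_K^{-1}\|v\|_K^2+\delta_K\|\Delta_xv\|_K^2\big).$$ **Lemma (boundedness).** Assume that $\theta_K\in\big(0,\tfrac{h_K}{d\,C_K^2}\big]$ for every $K\in\mathcal K_h$. Then $a_{loc,h}$ is uniformly bounded on $V_{0h,*}\times V_{0h}$: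 $$|a_{loc,h}(u,v_h)|\le\mu_{loc,b}\,|||u|||_{loc,h,*}\,|||v_h|||_{loc,h}\qquad\forall u\in V_{0h,*},\ \forall v_h\in V_{0h},$$ with the constant $\mu_{loc,b}=3$, which does not depend on the $h_K$. -/

import Mathlib

open MeasureTheory Set Filter Topology
open scoped ContDiff NNReal ENNReal

noncomputable section

namespace SpaceTimeIgA

/-! ### Domains -/

/-- Space-time `ℝ^d × ℝ`; a point is `(x, t)`. -/
abbrev SpT (d : ℕ) : Type := EuclideanSpace ℝ (Fin d) × ℝ

/-- Bounded domain (open and connected) with Lipschitz boundary: near each boundary point, in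
suitable orthonormal coordinates with last axis `ν`, it is the region above the graph of a Lipschitz
function `γ` of the remaining coordinates. -/
def IsLipschitzDomain {d : ℕ} (Ω : Set (EuclideanSpace ℝ (Fin d))) : Prop :=
  IsOpen Ω ∧ IsConnected Ω ∧ Bornology.IsBounded Ω ∧
    ∀ x ∈ frontier Ω, ∃ (ν : EuclideanSpace ℝ (Fin d)) (γ : EuclideanSpace ℝ (Fin d) → ℝ)
      (M : ℝ≥0) (r : ℝ), ‖ν‖ = 1 ∧ LipschitzWith M γ ∧ 0 < r ∧
        Ω ∩ Metric.ball x r =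
          {y | y ∈ Metric.ball x r ∧ γ (y - (inner ℝ ν y) • ν) < inner ℝ ν y}

/-- The space-time cylinder `Q = Ω × (0, T)`. -/
def cyl {d : ℕ} (Ω : Set (EuclideanSpace ℝ (Fin d))) (T : ℝ) : Set (SpT d) := Ω ×ˢ Ioo 0 T

/-- The `i`-th spatial coordinate direction. -/
def ex {d : ℕ} (i : Fin d) : SpT d := (EuclideanSpace.single i 1, 0)

/-- The time direction. -/
def et {d : ℕ} : SpT d := (0, 1)

/-- The Euclidean diameter of a subset of space-time. -/
def hdiam {d : ℕ} (K : Set (SpT d)) : ℝ := Metric.diam (WithLp.toLp 2 '' K)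

/-! ### Weak derivatives on an open set `U` -/

/-- Test functions `C_c^∞(U)`. -/
def IsTest {d : ℕ} (U : Set (SpT d)) (φ : SpT d → ℝ) : Prop :=
  ContDiff ℝ ∞ φ ∧ HasCompactSupport φ ∧ tsupport φ ⊆ U

/-- `g` is the weak derivative of `u` on `U` in the direction `e`. -/
def HasWeakDeriv {d : ℕ} (U : Set (SpT d)) (e : SpT d) (u g : SpT d → ℝ) : Prop :=
  LocallyIntegrableOn u U ∧ LocallyIntegrableOn g U ∧
    ∀ φ, IsTest U φ → ∫ z in U, u z * fderiv ℝ φ z e = - ∫ z in U, g z * φ z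

open Classical in
/-- The weak derivative (unique up to null sets); `0` if there is none. -/
def weakDeriv {d : ℕ} (U : Set (SpT d)) (e : SpT d) (u : SpT d → ℝ) : SpT d → ℝ :=
  if h : ∃ g, HasWeakDeriv U e u g then h.choose else 0

/-- Membership in `L₂(U)`. -/
def InL2 {d : ℕ} (U : Set (SpT d)) (u : SpT d → ℝ) : Prop := MemLp u 2 (volume.restrict U)

/-- The weak derivative in direction `e` exists and belongs to `L₂(U)`. -/
def DerivInL2 {d : ℕ} (U : Set (SpT d)) (e : SpT d) (u : SpT d → ℝ) : Prop :=
  ∃ g, HasWeakDeriv U e u g ∧ InL2 U g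

/-- `g` is the weak spatial divergence on `U` of the field `y` (with `d` spatial components). -/
def HasWeakDivx {d : ℕ} (U : Set (SpT d)) (y : Fin d → SpT d → ℝ) (g : SpT d → ℝ) : Prop :=
  (∀ i, LocallyIntegrableOn (y i) U) ∧ LocallyIntegrableOn g U ∧
    ∀ φ, IsTest U φ → ∫ z in U, ∑ i, y i z * fderiv ℝ φ z (ex i) = - ∫ z in U, g z * φ z

open Classical in
/-- The weak spatial divergence (unique up to null sets); `0` if there is none. -/
def weakDivx {d : ℕ} (U : Set (SpT d)) (y : Fin d → SpT d → ℝ) : SpT d → ℝ :=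
  if h : ∃ g, HasWeakDivx U y g then h.choose else 0

/-- `∇ₓ u` on `U`. -/
def gradx {d : ℕ} (U : Set (SpT d)) (u : SpT d → ℝ) : Fin d → SpT d → ℝ :=
  fun i => weakDeriv U (ex i) u

/-- `∂ₜ u` on `U`. -/
def dt {d : ℕ} (U : Set (SpT d)) (u : SpT d → ℝ) : SpT d → ℝ := weakDeriv U et u

/-- `Δₓ u = divₓ ∇ₓ u` on `U`. -/
def lapx {d : ℕ} (U : Set (SpT d)) (u : SpT d → ℝ) : SpT d → ℝ := weakDivx U (gradx U u)

/-- `y ∈ H^{divₓ,0}(U)`. -/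
def InHdivx {d : ℕ} (U : Set (SpT d)) (y : Fin d → SpT d → ℝ) : Prop :=
  (∀ i, InL2 U (y i)) ∧ ∃ g, HasWeakDivx U y g ∧ InL2 U g

/-- `w ∈ H¹(U)`. -/
def InH1 {d : ℕ} (U : Set (SpT d)) (w : SpT d → ℝ) : Prop :=
  InL2 U w ∧ (∀ i : Fin d, DerivInL2 U (ex i) w) ∧ DerivInL2 U et w

/-! ### Traces -/

/-- `g` is the trace of `u` along `r : Y → ℝ^d × ℝ` with respect to the measure `ν` on `Y`: the
restriction map of functions that are smooth on the closure of `Q`, extended by continuity with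
respect to the norm made of the `L₂(Q)` norms of the function and of its derivatives in the
directions belonging to `D`. -/
def HasTrace {d : ℕ} {Y : Type*} [MeasurableSpace Y] (Q : Set (SpT d)) (D : Set (SpT d))
    (ν : Measure Y) (r : Y → SpT d) (u : SpT d → ℝ) (g : Y → ℝ) : Prop :=
  ∃ φ : ℕ → SpT d → ℝ, (∀ n, ContDiff ℝ ∞ (φ n)) ∧
    Tendsto (fun n => eLpNorm (fun z => φ n z - u z) 2 (volume.restrict Q)) atTop (𝓝 0) ∧
    (∀ e ∈ D, Tendsto (fun n => eLpNorm (fun z => fderiv ℝ (φ n) z e - weakDeriv Q e u z) 2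
      (volume.restrict Q)) atTop (𝓝 0)) ∧
    Tendsto (fun n => eLpNorm (fun s => φ n (r s) - g s) 2 ν) atTop (𝓝 0)

/-- Surface measure on `Σ = ∂Ω × (0, T)`. -/
def lateralMeasure {d : ℕ} (Ω : Set (EuclideanSpace ℝ (Fin d))) (T : ℝ) : Measure (SpT d) :=
  ((Measure.hausdorffMeasure ((d : ℝ) - 1)).restrict (frontier Ω)).prod (volume.restrict (Ioo 0 T))

/-- `u = 0` on `Σ`, for `u` with `u, ∇ₓ u ∈ L₂(Q)`. -/
def VanishesOnLateral {d : ℕ} (Ω : Set (EuclideanSpace ℝ (Fin d))) (T : ℝ) (u : SpT d → ℝ) : Prop :=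
  HasTrace (cyl Ω T) (range ex) (lateralMeasure Ω T) id u 0

/-- `g` is the trace of `u` on `Ω × {s}`, for `u` with `u, ∂ₜ u ∈ L₂(Q)`. -/
def HasTimeTrace {d : ℕ} (Ω : Set (EuclideanSpace ℝ (Fin d))) (T s : ℝ) (u : SpT d → ℝ)
    (g : EuclideanSpace ℝ (Fin d) → ℝ) : Prop :=
  HasTrace (cyl Ω T) {et} (volume.restrict Ω) (fun x => (x, s)) u g

open Classical in
/-- The trace of `u` on `Σ_T = Ω × {T}` as an element of `L₂(Ω)`. -/
def traceT {d : ℕ} (Ω : Set (EuclideanSpace ℝ (Fin d))) (T : ℝ) (u : SpT d → ℝ) :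
    EuclideanSpace ℝ (Fin d) → ℝ :=
  if h : ∃ g, MemLp g 2 (volume.restrict Ω) ∧ HasTimeTrace Ω T T u g then h.choose else 0

/-! ### Function spaces on `Q` -/

/-- `V^{1,0}_0`: `u, ∇ₓ u ∈ L₂(Q)`, `u = 0` on `Σ`. -/
def V10 {d : ℕ} (Ω : Set (EuclideanSpace ℝ (Fin d))) (T : ℝ) : Set (SpT d → ℝ) :=
  {u | InL2 (cyl Ω T) u ∧ (∀ i : Fin d, DerivInL2 (cyl Ω T) (ex i) u) ∧ VanishesOnLateral Ω T u}

/-- `V^{0,1}_{0,0}`: `u, ∂ₜ u ∈ L₂(Q)`, `u = 0` on `Σ₀`. -/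
def V01 {d : ℕ} (Ω : Set (EuclideanSpace ℝ (Fin d))) (T : ℝ) : Set (SpT d → ℝ) :=
  {u | InL2 (cyl Ω T) u ∧ DerivInL2 (cyl Ω T) et u ∧ HasTimeTrace Ω T 0 u 0}

/-- `V¹_{0,0}`: `u ∈ V^{1,0}_0`, `∂ₜ u ∈ L₂(Q)`, `u = 0` on `Σ₀`. -/
def V1 {d : ℕ} (Ω : Set (EuclideanSpace ℝ (Fin d))) (T : ℝ) : Set (SpT d → ℝ) :=
  {u | u ∈ V10 Ω T ∧ DerivInL2 (cyl Ω T) et u ∧ HasTimeTrace Ω T 0 u 0}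

/-- `V^{Δₓ,1}_0`: `u ∈ V^{1,0}_0`, `Δₓ u ∈ L₂(Q)`, `∂ₜ u ∈ L₂(Q)`. -/
def VLap {d : ℕ} (Ω : Set (EuclideanSpace ℝ (Fin d))) (T : ℝ) : Set (SpT d → ℝ) :=
  {u | u ∈ V10 Ω T ∧
    (∃ g, HasWeakDivx (cyl Ω T) (gradx (cyl Ω T) u) g ∧ InL2 (cyl Ω T) g) ∧
    DerivInL2 (cyl Ω T) et u}

/-! ### B-splines and hierarchical meshes on the parameter domain -/

/-- Cox-de Boor recursion: `bspline ξ q i` is the B-spline of degree `q` with knots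
`ξ i, …, ξ (i + q + 1)`; a division by zero is zero. -/
def bspline (ξ : ℕ → ℝ) : ℕ → ℕ → ℝ → ℝ
  | 0, i, x => if ξ i ≤ x ∧ x < ξ (i + 1) then 1 else 0
  | q + 1, i, x =>
      (x - ξ i) / (ξ (i + q + 1) - ξ i) * bspline ξ q i x +
      (ξ (i + q + 2) - x) / (ξ (i + q + 2) - ξ (i + 1)) * bspline ξ q (i + 1) x

/-- Open knot vector on `[0, 1]` for `n` B-splines of degree `p`: the knots are
`knot 0 ≤ … ≤ knot (n + p)` (further values of the sequence play no role), the end knots `0` and `1`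
have multiplicity exactly `p + 1`, each inner knot has multiplicity at most `p - 1`. -/
structure OpenKnotVector (p : ℕ) where
  n : ℕ
  knot : ℕ → ℝ
  mono : Monotone knot
  knot_first : ∀ i ≤ p, knot i = 0
  knot_last : ∀ i, n ≤ i → i ≤ n + p → knot i = 1
  knot_inner : ∀ i, p < i → i < n → knot i ∈ Ioo (0 : ℝ) 1
  mult_inner : ∀ x ∈ Ioo (0 : ℝ) 1, ((Finset.range (n + p + 1)).filter (knot · = x)).card + 1 ≤ p

/-- The multiplicity of `x` in the knot vector. -/
def OpenKnotVector.mult {p : ℕ} (Ξ : OpenKnotVector p) (x : ℝ) : ℕ :=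
  ((Finset.range (Ξ.n + p + 1)).filter (Ξ.knot · = x)).card

/-- The parameter domain `(0, 1)^{d+1}`. -/
def parDomain (d : ℕ) : Set (Fin (d + 1) → ℝ) := Set.pi univ fun _ => Ioo 0 1

/-- Multi-indices of the tensor-product B-splines. -/
def basisIdx {d p : ℕ} (Ξ : Fin (d + 1) → OpenKnotVector p) : Finset (Fin (d + 1) → ℕ) :=
  Fintype.piFinset fun α => Finset.range (Ξ α).n

/-- Tensor-product B-spline. -/
def tbspline {d p : ℕ} (Ξ : Fin (d + 1) → OpenKnotVector p) (i : Fin (d + 1) → ℕ)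
    (ξ : Fin (d + 1) → ℝ) : ℝ :=
  ∏ α, bspline (Ξ α).knot p (i α) (ξ α)

/-- The open knot span with index `j`. -/
def cellBox {d p : ℕ} (Ξ : Fin (d + 1) → OpenKnotVector p) (j : Fin (d + 1) → ℕ) :
    Set (Fin (d + 1) → ℝ) :=
  Set.pi univ fun α => Ioo ((Ξ α).knot (j α)) ((Ξ α).knot (j α + 1))

open Classical in
/-- Indices of the nonempty knot spans. -/
def cells {d p : ℕ} (Ξ : Fin (d + 1) → OpenKnotVector p) : Finset (Fin (d + 1) → ℕ) :=
  (basisIdx Ξ).filter fun j => ∀ α, (Ξ α).knot (j α) < (Ξ α).knot (j α + 1)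

/-- The regions of a hierarchical mesh: the closed cube at level `0`, and at level `ℓ + 1` the union
of the closed cells of level `ℓ` that are marked for refinement. -/
def subdomain {d p : ℕ} (Ξ : ℕ → Fin (d + 1) → OpenKnotVector p)
    (refined : ℕ → Finset (Fin (d + 1) → ℕ)) : ℕ → Set (Fin (d + 1) → ℝ)
  | 0 => Icc 0 1
  | ℓ + 1 => ⋃ j ∈ refined ℓ, closure (cellBox (Ξ ℓ) j)

/-- Hierarchy of nested tensor-product knot vectors on levels `0, …, L`, with nested refinement
regions. The case `L = 0` is that of a tensor-product mesh. -/
structure Hierarchy (d p : ℕ) where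
  L : ℕ
  Ξ : ℕ → Fin (d + 1) → OpenKnotVector p
  nested : ∀ ℓ < L, ∀ α x, (Ξ ℓ α).mult x ≤ (Ξ (ℓ + 1) α).mult x
  refined : ℕ → Finset (Fin (d + 1) → ℕ)
  refined_subset : ∀ ℓ, refined ℓ ⊆ cells (Ξ ℓ)
  refined_top : ∀ ℓ, L ≤ ℓ → refined ℓ = ∅
  subdomain_anti : ∀ ℓ, subdomain Ξ refined (ℓ + 1) ⊆ subdomain Ξ refined ℓ

/-- The region of level `ℓ`. -/
def Hierarchy.region {d p : ℕ} (H : Hierarchy d p) (ℓ : ℕ) : Set (Fin (d + 1) → ℝ) :=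
  subdomain H.Ξ H.refined ℓ

open Classical in
/-- The parametric mesh: the cells of level `ℓ` in the region of level `ℓ` but not in that of
level `ℓ + 1`, for `ℓ = 0, …, L`. -/
def Hierarchy.parMesh {d p : ℕ} (H : Hierarchy d p) : Finset (Set (Fin (d + 1) → ℝ)) :=
  (Finset.range (H.L + 1)).biUnion fun ℓ =>
    ((cells (H.Ξ ℓ)).image (cellBox (H.Ξ ℓ))).filter
      fun B => B ⊆ H.region ℓ ∧ ¬ B ⊆ H.region (ℓ + 1)

/-- The hierarchical B-splines: those of level `ℓ` supported in the region of level `ℓ` but not in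
that of level `ℓ + 1`. Truncation does not change their span; for `L = 0` these are
the tensor-product B-splines. -/
def Hierarchy.basis {d p : ℕ} (H : Hierarchy d p) : Set ((Fin (d + 1) → ℝ) → ℝ) :=
  {β | ∃ ℓ ≤ H.L, ∃ i ∈ basisIdx (H.Ξ ℓ), β = tbspline (H.Ξ ℓ) i ∧
    parDomain d ∩ Function.support β ⊆ H.region ℓ ∧
    ¬ parDomain d ∩ Function.support β ⊆ H.region (ℓ + 1)}

/-! ### NURBS, geometry map, discrete spaces -/

/-- Admissible weights: positive, with sum one. -/
def IsWeight {d p : ℕ} (Ξ : Fin (d + 1) → OpenKnotVector p) (w : (Fin (d + 1) → ℕ) → ℝ) : Prop :=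
  (∀ i ∈ basisIdx Ξ, 0 < w i) ∧ ∑ i ∈ basisIdx Ξ, w i = 1

/-- The weighting function `W`. -/
def weightFun {d p : ℕ} (Ξ : Fin (d + 1) → OpenKnotVector p) (w : (Fin (d + 1) → ℕ) → ℝ)
    (ξ : Fin (d + 1) → ℝ) : ℝ :=
  ∑ i ∈ basisIdx Ξ, w i * tbspline Ξ i ξ

/-- The NURBS basis function `R_i`. -/
def nurbs {d p : ℕ} (Ξ : Fin (d + 1) → OpenKnotVector p) (w : (Fin (d + 1) → ℕ) → ℝ)
    (i : Fin (d + 1) → ℕ) (ξ : Fin (d + 1) → ℝ) : ℝ :=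
  w i * tbspline Ξ i ξ / weightFun Ξ w ξ

/-- The NURBS geometry map with control points `P_i`. -/
def geoMap {d p : ℕ} (Ξ : Fin (d + 1) → OpenKnotVector p) (w : (Fin (d + 1) → ℕ) → ℝ)
    (P : (Fin (d + 1) → ℕ) → SpT d) (ξ : Fin (d + 1) → ℝ) : SpT d :=
  ∑ i ∈ basisIdx Ξ, nurbs Ξ w i ξ • P i

/-- `Φ` maps the parameter domain bijectively onto `Q`, and on each (closed) element its inverse is
smooth. -/
def IsRegularMap {d p : ℕ} (H : Hierarchy d p) (Φ : (Fin (d + 1) → ℝ) → SpT d)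
    (Q : Set (SpT d)) : Prop :=
  BijOn Φ (parDomain d) Q ∧
    ∀ B ∈ H.parMesh, ∃ G : SpT d → (Fin (d + 1) → ℝ), ContDiff ℝ ∞ G ∧ ∀ ξ ∈ B, G (Φ ξ) = ξ

open Classical in
/-- The physical mesh. -/
def physMesh {d p : ℕ} (H : Hierarchy d p) (Φ : (Fin (d + 1) → ℝ) → SpT d) :
    Finset (Set (SpT d)) :=
  H.parMesh.image fun B => Φ '' B

/-- The discrete space `V_h`: push-forward by `Φ` of the (hierarchical) splines, divided by the
weighting function of `κ`. For `L = 0` these are the NURBS with weights `κ`; for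
constant weights `κ` they are the B-splines (if `L = 0`) or the span of the THB-splines. -/
def Vh {d p : ℕ} (H : Hierarchy d p) (κ : (Fin (d + 1) → ℕ) → ℝ)
    (Φ : (Fin (d + 1) → ℝ) → SpT d) : Submodule ℝ (SpT d → ℝ) :=
  Submodule.span ℝ {v | ∃ β ∈ H.basis,
    v = fun z => β (Function.invFunOn Φ (parDomain d) z) /
      weightFun (H.Ξ 0) κ (Function.invFunOn Φ (parDomain d) z)}

/-- `V_{0h} = V_h ∩ V¹_{0,0}`. -/
def V0h {d : ℕ} (Ω : Set (EuclideanSpace ℝ (Fin d))) (T : ℝ) (S : Submodule ℝ (SpT d → ℝ)) :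
    Set (SpT d → ℝ) :=
  {v | v ∈ S ∧ v ∈ V1 Ω T}

/-- `V_{0h,*} = V¹_{0,0} ∩ V^{Δₓ,1}_{0,0} + V_{0h}`, where
`V^{Δₓ,1}_{0,0} = V^{Δₓ,1}_0 ∩ V^{0,1}_{0,0}`. -/
def V0hStar {d : ℕ} (Ω : Set (EuclideanSpace ℝ (Fin d))) (T : ℝ) (S : Submodule ℝ (SpT d → ℝ)) :
    Set (SpT d → ℝ) :=
  {u | ∃ w ∈ V1 Ω T ∩ (VLap Ω T ∩ V01 Ω T), ∃ v ∈ V0h Ω T S, u = w + v}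

/-! ### The bilinear form and the norms -/

/-- `(f, g)_U`. -/
def ip {d : ℕ} (U : Set (SpT d)) (f g : SpT d → ℝ) : ℝ := ∫ z in U, f z * g z

/-- `(y, q)_U` for fields with `d` components. -/
def ipv {d : ℕ} (U : Set (SpT d)) (y q : Fin d → SpT d → ℝ) : ℝ := ∫ z in U, ∑ i, y i z * q i z

open Classical in
/-- The duality product `⟨n_x · y, w⟩` on `∂K`, in `H^{-1/2}(∂K) × H^{1/2}(∂K)`, of the
normal trace of `y ∈ H^{divₓ,0}(K)` and the trace of `w ∈ H¹(K)`. The normal trace of a field which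
is merely in `H(div)` is, by definition, the functional given by Green's formula. -/
def normalPairing {d : ℕ} (K : Set (SpT d)) (y : Fin d → SpT d → ℝ) (w : SpT d → ℝ) : ℝ :=
  if InHdivx K y ∧ InH1 K w then ipv K y (gradx K w) + ip K (weakDivx K y) w else 0

theorem ae_eq_of_isTest {d : ℕ} {U : Set (SpT d)} (hU : IsOpen U) {g g' : SpT d → ℝ}
    (hg : LocallyIntegrableOn g U) (hg' : LocallyIntegrableOn g' U)
    (h : ∀ φ, IsTest U φ → ∫ z in U, g z * φ z = ∫ z in U, g' z * φ z) :
    g =ᵐ[volume.restrict U] g' := by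
  have key := hU.ae_eq_zero_of_integral_contDiff_smul_eq_zero (μ := (volume : Measure (SpT d)))
    (f := fun z => g z - g' z) (hg.sub hg') ?_
  · rw [Filter.EventuallyEq, ae_restrict_iff' hU.measurableSet]
    filter_upwards [key] with z hz hzU using sub_eq_zero.1 (hz hzU)
  · intro φ h1 h2 h3
    have s : ∀ f : SpT d → ℝ, ∫ z in U, f z * φ z = ∫ z, φ z * f z := by
      intro f
      rw [setIntegral_eq_integral_of_forall_compl_eq_zero]
      · simp only [mul_comm]
      · intro z hz
        rw [image_eq_zero_of_notMem_tsupport (fun hh => hz (h3 hh)), mul_zero]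
    have i : ∀ f : SpT d → ℝ, LocallyIntegrableOn f U → Integrable (fun z => φ z * f z) := by
      intro f hf
      refine (integrableOn_iff_integrable_of_support_subset (s := tsupport φ) ?_).1
        ((hf.integrableOn_compact_subset h3 h2).continuousOn_mul h1.continuous.continuousOn h2)
      exact (Function.support_mul_subset_left _ _).trans (subset_tsupport φ)
    simp only [smul_eq_mul, mul_sub]
    rw [integral_sub (i g hg) (i g' hg'), ← s g, ← s g', h φ ⟨h1, h2, h3⟩, sub_self]

theorem HasWeakDivx.ae_eq {d : ℕ} {U : Set (SpT d)} (hU : IsOpen U) {y : Fin d → SpT d → ℝ}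
    {g g' : SpT d → ℝ} (h : HasWeakDivx U y g) (h' : HasWeakDivx U y g') :
    g =ᵐ[volume.restrict U] g' :=
  ae_eq_of_isTest hU h.2.1 h'.2.1 fun φ hφ => by
    have e1 := h.2.2 φ hφ
    have e2 := h'.2.2 φ hφ
    linarith

theorem HasWeakDeriv.ae_eq {d : ℕ} {U : Set (SpT d)} (hU : IsOpen U) {e : SpT d}
    {u g g' : SpT d → ℝ} (h : HasWeakDeriv U e u g) (h' : HasWeakDeriv U e u g') :
    g =ᵐ[volume.restrict U] g' :=
  ae_eq_of_isTest hU h.2.1 h'.2.1 fun φ hφ => by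
    have e1 := h.2.2 φ hφ
    have e2 := h'.2.2 φ hφ
    linarith

theorem tendsto_integral_mul_L2 {α : Type*} [MeasurableSpace α] {μ : Measure α} {f g : α → ℝ}
    {G : ℕ → α → ℝ} (hf : MemLp f 2 μ) (hg : MemLp g 2 μ) (hG : ∀ n, MemLp (G n) 2 μ)
    (h : Tendsto (fun n => eLpNorm (fun z => G n z - g z) 2 μ) atTop (𝓝 0)) :
    Tendsto (fun n => ∫ z, f z * G n z ∂μ) atTop (𝓝 (∫ z, f z * g z ∂μ)) := by
  refine tendsto_integral_of_L1' (fun z => f z * g z) (hf.integrable_mul hg).aestronglyMeasurable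
    (F := fun n z => f z * G n z) (Eventually.of_forall fun n => hf.integrable_mul (hG n)) ?_
  have hb : Tendsto (fun n => eLpNorm f 2 μ * eLpNorm (fun z => G n z - g z) 2 μ) atTop (𝓝 0) := by
    have := ENNReal.Tendsto.const_mul h (Or.inr hf.eLpNorm_ne_top)
    simpa using this
  refine tendsto_of_tendsto_of_tendsto_of_le_of_le tendsto_const_nhds hb (fun n => zero_le) ?_
  intro n
  have e : (fun z => f z * G n z) - (fun z => f z * g z) = f • (fun z => G n z - g z) := by
    ext z
    simp [mul_sub]
  show eLpNorm ((fun z => f z * G n z) - (fun z => f z * g z)) 1 μ ≤ _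
  rw [e]
  exact eLpNorm_smul_le_mul_eLpNorm (p := 2) (q := 2) (r := 1) ((hG n).1.sub hg.1) hf.1

/-- The duality product depends on `w ∈ H¹(K)` only through its trace on `∂K`: it vanishes on
`H¹₀(K)`, the closure of the test functions. -/
theorem normalPairing_eq_zero {d : ℕ} {K : Set (SpT d)} (hK : IsOpen K) {y : Fin d → SpT d → ℝ}
    {w : SpT d → ℝ} (hy : InHdivx K y) (hw : InH1 K w) (φ : ℕ → SpT d → ℝ)
    (hφ : ∀ n, IsTest K (φ n))
    (h0 : Tendsto (fun n => eLpNorm (fun z => φ n z - w z) 2 (volume.restrict K)) atTop (𝓝 0))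
    (h1 : ∀ i, Tendsto (fun n => eLpNorm (fun z => fderiv ℝ (φ n) z (ex i) - gradx K w i z) 2
      (volume.restrict K)) atTop (𝓝 0)) :
    normalPairing K y w = 0 := by
  classical
  rw [normalPairing, if_pos ⟨hy, hw⟩]
  obtain ⟨hyL, g, hg, hgL⟩ := hy
  have hdiv : HasWeakDivx K y (weakDivx K y) := by
    have hex : ∃ g, HasWeakDivx K y g := ⟨g, hg⟩
    rw [weakDivx, dif_pos hex]
    exact hex.choose_spec
  have hdivL : MemLp (weakDivx K y) 2 (volume.restrict K) :=
    hgL.ae_eq (hg.ae_eq hK hdiv)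
  have hgrad : ∀ i, MemLp (gradx K w i) 2 (volume.restrict K) := by
    intro i
    obtain ⟨k, hk, hkL⟩ := hw.2.1 i
    have hex : ∃ g, HasWeakDeriv K (ex i) w g := ⟨k, hk⟩
    have : HasWeakDeriv K (ex i) w (gradx K w i) := by
      rw [gradx, weakDeriv, dif_pos hex]
      exact hex.choose_spec
    exact hkL.ae_eq (hk.ae_eq hK this)
  have hφL : ∀ n, MemLp (φ n) 2 (volume.restrict K) := fun n =>
    ((hφ n).1.continuous.memLp_of_hasCompactSupport (hφ n).2.1).restrict K
  have hdφL : ∀ n (i : Fin d), MemLp (fun z => fderiv ℝ (φ n) z (ex i)) 2 (volume.restrict K) := by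
    intro n i
    have hc : Continuous fun z => fderiv ℝ (φ n) z (ex i) :=
      ((hφ n).1.continuous_fderiv (by simp)).clm_apply continuous_const
    have hs : HasCompactSupport fun z => fderiv ℝ (φ n) z (ex i) := (hφ n).2.1.fderiv_apply ℝ (ex i)
    exact (hc.memLp_of_hasCompactSupport hs).restrict K
  have t0 := tendsto_integral_mul_L2 hdivL hw.1 hφL h0
  have t1 := fun i => tendsto_integral_mul_L2 (hyL i) (hgrad i) (fun n => hdφL n i) (h1 i)
  have t2 := (tendsto_finsetSum Finset.univ fun i _ => t1 i).add t0
  have hz : ∀ n, (∑ i, ∫ z in K, y i z * fderiv ℝ (φ n) z (ex i)) +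
      ∫ z in K, weakDivx K y z * φ n z = 0 := by
    intro n
    rw [← integral_finsetSum Finset.univ (f := fun i z => y i z * fderiv ℝ (φ n) z (ex i))
      fun i _ => (hyL i).integrable_mul (hdφL n i), hdiv.2.2 _ (hφ n)]
    ring
  simp only [hz] at t2
  have := tendsto_nhds_unique t2 tendsto_const_nhds
  rw [ipv, ip, integral_finsetSum Finset.univ (f := fun i z => y i z * gradx K w i z)
    fun i _ => (hyL i).integrable_mul (hgrad i)]
  exact this

/-- The bilinear form `a_{loc,h}`. -/
def aloc {d : ℕ} (Ω : Set (EuclideanSpace ℝ (Fin d))) (T : ℝ) (mesh : Finset (Set (SpT d)))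
    (δ : Set (SpT d) → ℝ) (u v : SpT d → ℝ) : ℝ :=
  ip (cyl Ω T) (dt (cyl Ω T) u) v + ipv (cyl Ω T) (gradx (cyl Ω T) u) (gradx (cyl Ω T) v) +
    ∑ K ∈ mesh, δ K * (ip K (dt K u) (dt K v) + ipv K (gradx K u) (gradx K (dt K v)) -
      normalPairing K (gradx K u) (dt K v))

/-- The norm `|||v|||_{loc,h}`. -/
def normLoc {d : ℕ} (Ω : Set (EuclideanSpace ℝ (Fin d))) (T : ℝ) (mesh : Finset (Set (SpT d)))
    (δ : Set (SpT d) → ℝ) (v : SpT d → ℝ) : ℝ :=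
  Real.sqrt (ipv (cyl Ω T) (gradx (cyl Ω T) v) (gradx (cyl Ω T) v) +
    1 / 2 * (∫ x in Ω, traceT Ω T v x ^ 2) + ∑ K ∈ mesh, δ K * ip K (dt K v) (dt K v))

/-- The norm `|||v|||_{loc,h,*}`. -/
def normLocStar {d : ℕ} (Ω : Set (EuclideanSpace ℝ (Fin d))) (T : ℝ) (mesh : Finset (Set (SpT d)))
    (δ : Set (SpT d) → ℝ) (v : SpT d → ℝ) : ℝ :=
  Real.sqrt (normLoc Ω T mesh δ v ^ 2 +
    ∑ K ∈ mesh, ((δ K)⁻¹ * ip K v v + δ K * ip K (lapx K v) (lapx K v)))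

/-- `C` is a constant in the inverse inequality `‖∇ₓ v‖_K ≤ C h_K⁻¹ ‖v‖_K` on the discrete space. -/
def IsInverseConst {d : ℕ} (S : Submodule ℝ (SpT d → ℝ)) (K : Set (SpT d)) (C : ℝ) : Prop :=
  0 < C ∧ ∀ v ∈ S,
    Real.sqrt (ipv K (gradx K v) (gradx K v)) ≤ C * (hdiam K)⁻¹ * Real.sqrt (ip K v v)

end SpaceTimeIgA

end

open SpaceTimeIgA

namespace SpaceTimeIgA

/-! ### Continuous functions on bounded sets -/

/-! The form is rewritten until every term is matched by a pair of terms of the two norms. On an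
element, Green's formula (the definition of the normal trace) turns `(∇ₓu, ∇ₓ∂ₜv)_K - ⟨n·∇ₓu, ∂ₜv⟩`
into `-(Δₓu, ∂ₜv)_K`. In time, both functions vanish at `t = 0`, so `(∂ₜu, v)_Q` equals the product
of the traces on `Σ_T` minus `(u, ∂ₜv)_Q`, and the last integral splits over the elements. There
`‖u‖_K` is paired with `‖∂ₜv‖_K` through the weights `δ_K⁻¹` and `δ_K`. Cauchy-Schwarz then gives
the factor `√2 · √3 ≤ 3`: the `2` undoes the weight `1/2` of the trace, the `3` counts the volume
terms of an element (`abs_aloc_le`, `sum_bounds_le`).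

The rest justifies these steps. Green's formula needs `∇ₓu` in `H(divₓ)` and `∂ₜv` in `H¹` on each
element. This holds because a discrete function is, on an element, the restriction of a function
smooth on the whole space: splines are polynomial on knot spans, the weighting function is bounded
below, and the geometry map has a smooth inverse there (`extendsSmoothly_of_mem_Vh`). Splitting the
integral needs open, disjoint elements that exhaust `Q` up to a null set
(`setIntegral_eq_sum_physMesh`). Integration by parts in time passes to the limit from smooth
functions by a trace inequality at the end times (`integral_by_parts_time`). -/

theorem integrableOn_of_continuous {E : Type*} [MetricSpace E] [ProperSpace E]
    [MeasurableSpace E] [OpensMeasurableSpace E] {ν : Measure E} [IsFiniteMeasureOnCompacts ν]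
    {U : Set E} (hU : Bornology.IsBounded U) {f : E → ℝ} (hf : Continuous f) :
    IntegrableOn f U ν :=
  (hf.continuousOn.integrableOn_compact hU.isCompact_closure).mono_set subset_closure

theorem memLp_two_restrict_of_continuous {E : Type*} [MetricSpace E] [ProperSpace E]
    [MeasurableSpace E] [OpensMeasurableSpace E] {ν : Measure E} [IsFiniteMeasureOnCompacts ν]
    {U : Set E} (hU : Bornology.IsBounded U) {f : E → ℝ} (hf : Continuous f) :
    MemLp f 2 (ν.restrict U) :=
  (memLp_two_iff_integrable_sq (integrableOn_of_continuous hU hf).aestronglyMeasurable).2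
    (integrableOn_of_continuous hU (hf.pow 2))

/-! ### Weak derivatives -/

section WeakDerivatives

variable {d : ℕ} {U K : Set (SpT d)} {e : SpT d} {u v g f : SpT d → ℝ}

theorem IsTest.mono {φ : SpT d → ℝ} (hφ : IsTest K φ) (h : K ⊆ U) : IsTest U φ :=
  ⟨hφ.1, hφ.2.1, hφ.2.2.trans h⟩

theorem IsTest.fderiv_apply {φ : SpT d → ℝ} (hφ : IsTest U φ) (e : SpT d) :
    IsTest U fun z => fderiv ℝ φ z e :=
  ⟨(hφ.1.fderiv_right (m := ∞) (by simp)).clm_apply contDiff_const, hφ.2.1.fderiv_apply ℝ e,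
    (tsupport_fderiv_apply_subset ℝ e).trans hφ.2.2⟩

theorem IsTest.integrable_mul {φ : SpT d → ℝ} (hφ : IsTest U φ) (hf : LocallyIntegrableOn f U) :
    Integrable fun z => f z * φ z := by
  refine (integrableOn_iff_integrable_of_support_subset (s := tsupport φ) ?_).1
    ((hf.integrableOn_compact_subset hφ.2.2 hφ.2.1).mul_continuousOn hφ.1.continuous.continuousOn
      hφ.2.1)
  exact (Function.support_mul_subset_right _ _).trans (subset_tsupport φ)

/-- The domain of integration does not matter once it contains the support; this carries test
identities from `U` to a subset. -/
theorem IsTest.setIntegral_mul {φ : SpT d → ℝ} (hφ : IsTest U φ) (f : SpT d → ℝ) :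
    ∫ z in U, f z * φ z = ∫ z, f z * φ z := by
  rw [setIntegral_eq_integral_of_forall_compl_eq_zero]
  intro z hz
  rw [image_eq_zero_of_notMem_tsupport fun hh => hz (hφ.2.2 hh), mul_zero]

theorem HasWeakDeriv.mono (h : HasWeakDeriv U e u g) (hK : K ⊆ U) : HasWeakDeriv K e u g := by
  refine ⟨h.1.mono_set hK, h.2.1.mono_set hK, fun φ hφ => ?_⟩
  have := h.2.2 φ (hφ.mono hK)
  rwa [(hφ.mono hK).setIntegral_mul, ((hφ.mono hK).fderiv_apply e).setIntegral_mul,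
    ← hφ.setIntegral_mul, ← (hφ.fderiv_apply e).setIntegral_mul] at this

theorem HasWeakDeriv.add {g' : SpT d → ℝ} (h : HasWeakDeriv U e u g) (h' : HasWeakDeriv U e v g') :
    HasWeakDeriv U e (u + v) (g + g') := by
  refine ⟨h.1.add h'.1, h.2.1.add h'.2.1, fun φ hφ => ?_⟩
  have hd := hφ.fderiv_apply e
  simp only [Pi.add_apply, add_mul]
  rw [integral_add (hd.integrable_mul h.1).integrableOn (hd.integrable_mul h'.1).integrableOn,
    integral_add (hφ.integrable_mul h.2.1).integrableOn (hφ.integrable_mul h'.2.1).integrableOn,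
    h.2.2 φ hφ, h'.2.2 φ hφ]
  ring

theorem setIntegral_mul_congr {f f' : SpT d → ℝ} (h : f =ᵐ[volume.restrict U] f')
    (φ : SpT d → ℝ) : ∫ z in U, f z * φ z = ∫ z in U, f' z * φ z :=
  integral_congr_ae (by filter_upwards [h] with z hz; rw [hz])

theorem HasWeakDeriv.congr {g' : SpT d → ℝ} (h : HasWeakDeriv U e u g)
    (hu : u =ᵐ[volume.restrict U] v) (hg : g =ᵐ[volume.restrict U] g') :
    HasWeakDeriv U e v g' := by
  refine ⟨h.1.congr hu, h.2.1.congr hg, fun φ hφ => ?_⟩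
  rw [← setIntegral_mul_congr hu fun z => fderiv ℝ φ z e, ← setIntegral_mul_congr hg φ, h.2.2 φ hφ]

/-- `weakDeriv` is an arbitrary choice among representatives, so facts about it come from this
property and almost everywhere uniqueness. -/
theorem HasWeakDeriv.hasWeakDeriv_weakDeriv (h : HasWeakDeriv U e u g) :
    HasWeakDeriv U e u (weakDeriv U e u) := by
  have hex : ∃ g, HasWeakDeriv U e u g := ⟨g, h⟩
  rw [weakDeriv, dif_pos hex]
  exact hex.choose_spec

theorem HasWeakDeriv.weakDeriv_ae_eq (hU : IsOpen U) (h : HasWeakDeriv U e u g) :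
    weakDeriv U e u =ᵐ[volume.restrict U] g :=
  h.hasWeakDeriv_weakDeriv.ae_eq hU h

theorem DerivInL2.hasWeakDeriv (h : DerivInL2 U e u) : HasWeakDeriv U e u (weakDeriv U e u) :=
  h.choose_spec.1.hasWeakDeriv_weakDeriv

theorem DerivInL2.inL2 (hU : IsOpen U) (h : DerivInL2 U e u) : InL2 U (weakDeriv U e u) := by
  obtain ⟨g, hg, hL⟩ := h
  exact MemLp.ae_eq (hg.weakDeriv_ae_eq hU).symm hL

/-- The bilinear form uses derivatives chosen separately on `Q` and on each element; this reconciles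
the choices. -/
theorem DerivInL2.weakDeriv_restrict (hK : IsOpen K) (hKU : K ⊆ U) (h : DerivInL2 U e u) :
    weakDeriv K e u =ᵐ[volume.restrict K] weakDeriv U e u :=
  (h.hasWeakDeriv.mono hKU).weakDeriv_ae_eq hK

theorem InL2.mono (h : InL2 U u) (hK : K ⊆ U) : InL2 K u :=
  MemLp.mono_measure (Measure.restrict_mono hK le_rfl) h

theorem DerivInL2.mono (h : DerivInL2 U e u) (hK : K ⊆ U) : DerivInL2 K e u :=
  let ⟨g, hg, hL⟩ := h
  ⟨g, hg.mono hK, hL.mono hK⟩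

theorem DerivInL2.add (h : DerivInL2 U e u) (h' : DerivInL2 U e v) : DerivInL2 U e (u + v) :=
  let ⟨g, hg, hL⟩ := h
  let ⟨g', hg', hL'⟩ := h'
  ⟨g + g', hg.add hg', MemLp.add hL hL'⟩

theorem DerivInL2.weakDeriv_add (hU : IsOpen U) (h : DerivInL2 U e u) (h' : DerivInL2 U e v) :
    weakDeriv U e (u + v) =ᵐ[volume.restrict U] weakDeriv U e u + weakDeriv U e v :=
  (h.hasWeakDeriv.add h'.hasWeakDeriv).weakDeriv_ae_eq hU

theorem HasWeakDivx.mono {y : Fin d → SpT d → ℝ} (h : HasWeakDivx U y g) (hK : K ⊆ U) :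
    HasWeakDivx K y g := by
  refine ⟨fun i => (h.1 i).mono_set hK, h.2.1.mono_set hK, fun φ hφ => ?_⟩
  have hφU := hφ.mono hK
  have := h.2.2 φ hφU
  rw [integral_finsetSum Finset.univ (f := fun i z => y i z * fderiv ℝ φ z (ex i))
    fun i _ => ((hφU.fderiv_apply _).integrable_mul (h.1 i)).integrableOn] at this
  rw [integral_finsetSum Finset.univ (f := fun i z => y i z * fderiv ℝ φ z (ex i))
    fun i _ => ((hφU.fderiv_apply _).integrable_mul (h.1 i)).integrableOn, hφ.setIntegral_mul,
    ← hφU.setIntegral_mul, ← this]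
  refine Finset.sum_congr rfl fun i _ => ?_
  rw [(hφ.fderiv_apply _).setIntegral_mul, (hφU.fderiv_apply _).setIntegral_mul]

theorem HasWeakDivx.add {y y' : Fin d → SpT d → ℝ} {g' : SpT d → ℝ} (h : HasWeakDivx U y g)
    (h' : HasWeakDivx U y' g') : HasWeakDivx U (y + y') (g + g') := by
  refine ⟨fun i => (h.1 i).add (h'.1 i), h.2.1.add h'.2.1, fun φ hφ => ?_⟩
  have hi : ∀ i : Fin d, Integrable (fun z => y i z * fderiv ℝ φ z (ex i)) (volume.restrict U) :=
    fun i => ((hφ.fderiv_apply _).integrable_mul (h.1 i)).integrableOn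
  have hi' : ∀ i : Fin d, Integrable (fun z => y' i z * fderiv ℝ φ z (ex i)) (volume.restrict U) :=
    fun i => ((hφ.fderiv_apply _).integrable_mul (h'.1 i)).integrableOn
  simp only [Pi.add_apply, add_mul, Finset.sum_add_distrib]
  rw [integral_add (integrable_finsetSum _ fun i _ => hi i)
    (integrable_finsetSum _ fun i _ => hi' i),
    integral_add (hφ.integrable_mul h.2.1).integrableOn (hφ.integrable_mul h'.2.1).integrableOn,
    h.2.2 φ hφ, h'.2.2 φ hφ]
  ring

theorem HasWeakDivx.congr {y y' : Fin d → SpT d → ℝ} (h : HasWeakDivx U y g)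
    (hy : ∀ i, y i =ᵐ[volume.restrict U] y' i) : HasWeakDivx U y' g := by
  refine ⟨fun i => (h.1 i).congr (hy i), h.2.1, fun φ hφ => ?_⟩
  rw [← h.2.2 φ hφ]
  refine integral_congr_ae ?_
  filter_upwards [ae_all_iff.2 hy] with z hz
  simp only [hz]

theorem hasWeakDivx_sum {y g : Fin d → SpT d → ℝ} (hd : 0 < d)
    (h : ∀ i, HasWeakDeriv U (ex i) (y i) (g i)) : HasWeakDivx U y (∑ i, g i) := by
  have hsum : ∀ s : Finset (Fin d), s.Nonempty → LocallyIntegrableOn (∑ i ∈ s, g i) U := by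
    intro s hs
    induction hs using Finset.Nonempty.cons_induction with
    | singleton a => simpa using (h a).2.1
    | cons a s ha _ ih => rw [Finset.sum_cons]; exact (h a).2.1.add ih
  have : Nonempty (Fin d) := ⟨⟨0, hd⟩⟩
  refine ⟨fun i => (h i).1, hsum _ Finset.univ_nonempty, fun φ hφ => ?_⟩
  rw [integral_finsetSum Finset.univ (f := fun i z => y i z * fderiv ℝ φ z (ex i))
    fun i _ => ((hφ.fderiv_apply _).integrable_mul (h i).1).integrableOn]
  simp only [Finset.sum_apply, Finset.sum_mul]
  rw [integral_finsetSum Finset.univ (f := fun i z => g i z * φ z)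
    fun i _ => (hφ.integrable_mul (h i).2.1).integrableOn, ← Finset.sum_neg_distrib]
  exact Finset.sum_congr rfl fun i _ => (h i).2.2 φ hφ

theorem HasWeakDivx.hasWeakDivx_weakDivx {y : Fin d → SpT d → ℝ} (h : HasWeakDivx U y g) :
    HasWeakDivx U y (weakDivx U y) := by
  have hex : ∃ g, HasWeakDivx U y g := ⟨g, h⟩
  rw [weakDivx, dif_pos hex]
  exact hex.choose_spec

theorem InHdivx.weakDivx_inL2 (hU : IsOpen U) {y : Fin d → SpT d → ℝ} (h : InHdivx U y) :
    InL2 U (weakDivx U y) := by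
  obtain ⟨-, g, hg, hL⟩ := h
  exact MemLp.ae_eq (hg.ae_eq hU hg.hasWeakDivx_weakDivx) hL

instance isAddHaarMeasure_volume (d : ℕ) : (volume : Measure (SpT d)).IsAddHaarMeasure :=
  inferInstanceAs ((volume : Measure (EuclideanSpace ℝ (Fin d))).prod
    (volume : Measure ℝ)).IsAddHaarMeasure

/-- Since `φ` has compact support in `U`, the classical integration by parts for `F` and `φ` takes
place on the whole space, and only the values of `F` on `U` enter. -/
theorem hasWeakDeriv_of_contDiff (hU : IsOpen U) {F : SpT d → ℝ} (hF : ContDiff ℝ ∞ F)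
    (e : SpT d) (h : EqOn u F U) : HasWeakDeriv U e u fun z => fderiv ℝ F z e := by
  have hF' : Continuous fun z => fderiv ℝ F z e :=
    (hF.continuous_fderiv (by simp)).clm_apply continuous_const
  have hae : F =ᵐ[volume.restrict U] u :=
    (ae_restrict_iff' hU.measurableSet).2 (Eventually.of_forall fun z hz => (h hz).symm)
  have lF := hF.continuous.locallyIntegrable (μ := volume)
  have lF' := hF'.locallyIntegrable (μ := (volume : Measure (SpT d)))
  refine HasWeakDeriv.congr (u := F) ⟨lF.locallyIntegrableOn U, lF'.locallyIntegrableOn U, ?_⟩ hae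
    .rfl
  intro φ hφ
  rw [hφ.setIntegral_mul, (hφ.fderiv_apply e).setIntegral_mul]
  exact integral_mul_fderiv_eq_neg_fderiv_mul_of_integrable
    (hφ.integrable_mul (lF'.locallyIntegrableOn U))
    ((hφ.fderiv_apply e).integrable_mul (lF.locallyIntegrableOn U))
    (hφ.integrable_mul (lF.locallyIntegrableOn U))
    (fun z _ => (hF.differentiable (by simp)).differentiableAt)
    (fun z _ => (hφ.1.differentiable (by simp)).differentiableAt)

/-- A function that extends smoothly from a bounded open set `U` to the whole space has gradient in
`H^{divₓ,0}(U)` and time derivative in `H¹(U)`. -/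
theorem inHdivx_inH1_of_contDiff (hd : 0 < d) (hU : IsOpen U) (hb : Bornology.IsBounded U)
    {F : SpT d → ℝ} (hF : ContDiff ℝ ∞ F) (h : EqOn u F U) :
    InHdivx U (gradx U u) ∧ InH1 U (dt U u) := by
  have hdF : ∀ e, ContDiff ℝ ∞ fun z => fderiv ℝ F z e := fun e =>
    (hF.fderiv_right (m := ∞) (by simp)).clm_apply contDiff_const
  have hddF : ∀ e e', Continuous fun z => fderiv ℝ (fun z => fderiv ℝ F z e) z e' := fun e e' =>
    ((hdF e).continuous_fderiv (by simp)).clm_apply continuous_const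
  have hae : ∀ e, (fun z => fderiv ℝ F z e) =ᵐ[volume.restrict U] weakDeriv U e u := fun e =>
    ((hasWeakDeriv_of_contDiff hU hF e h).weakDeriv_ae_eq hU).symm
  have hL : ∀ e, InL2 U (weakDeriv U e u) := fun e =>
    MemLp.ae_eq (hae e) (memLp_two_restrict_of_continuous hb (hdF e).continuous)
  have hw : ∀ e e', HasWeakDeriv U e' (weakDeriv U e u)
      fun z => fderiv ℝ (fun z => fderiv ℝ F z e) z e' := fun e e' =>
    (hasWeakDeriv_of_contDiff hU (hdF e) e' fun _ _ => rfl).congr (hae e) .rfl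
  refine ⟨⟨fun i => hL _, _, hasWeakDivx_sum hd fun i => hw (ex i) (ex i), ?_⟩, hL _,
    fun i => ⟨_, hw _ _, memLp_two_restrict_of_continuous hb (hddF _ _)⟩,
    ⟨_, hw _ _, memLp_two_restrict_of_continuous hb (hddF _ _)⟩⟩
  exact memLp_finsetSum' _ fun i _ => memLp_two_restrict_of_continuous hb (hddF _ _)

end WeakDerivatives

/-! ### B-splines -/

section BSplines

variable {ξ : ℕ → ℝ}

theorem bspline_eq_zero (hξ : Monotone ξ) (q : ℕ) :
    ∀ i x, x ∉ Ico (ξ i) (ξ (i + q + 1)) → bspline ξ q i x = 0 := by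
  induction q with
  | zero =>
    intro i x hx
    rw [bspline, if_neg]
    simpa using hx
  | succ q ih =>
    intro i x hx
    have h1 : bspline ξ q i x = 0 := by
      refine ih i x fun h => hx ⟨h.1, h.2.trans_le (hξ (by omega))⟩
    have h2 : bspline ξ q (i + 1) x = 0 := by
      refine ih (i + 1) x fun h => hx ⟨(hξ (by omega)).trans h.1, ?_⟩
      have := h.2
      rwa [show i + 1 + q + 1 = i + (q + 1) + 1 by ring] at this
    rw [bspline, h1, h2]
    simp

/-- The affine coefficients of the recursion can be negative, but only where the spline they
multiply vanishes. -/
theorem bspline_nonneg (hξ : Monotone ξ) (q : ℕ) : ∀ i x, 0 ≤ bspline ξ q i x := by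
  induction q with
  | zero =>
    intro i x
    rw [bspline]
    split_ifs <;> norm_num
  | succ q ih =>
    intro i x
    rw [bspline]
    refine add_nonneg ?_ ?_
    · by_cases h : x ∈ Ico (ξ i) (ξ (i + q + 1))
      · exact mul_nonneg (div_nonneg (sub_nonneg.2 h.1) (sub_nonneg.2 (hξ (by omega)))) (ih i x)
      · simp [bspline_eq_zero hξ q i x h]
    · by_cases h : x ∈ Ico (ξ (i + 1)) (ξ (i + 1 + q + 1))
      · refine mul_nonneg (div_nonneg (sub_nonneg.2 ?_) (sub_nonneg.2 (hξ (by omega)))) (ih _ x)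
        have := h.2.le
        rwa [show i + 1 + q + 1 = i + q + 2 by ring] at this
      · simp [bspline_eq_zero hξ q (i + 1) x h]

/-- Partition of unity. -/
theorem sum_bspline (hξ : Monotone ξ) {m : ℕ} (q : ℕ) :
    ∀ x, x ∈ Ico (ξ q) (ξ m) → ∑ i ∈ Finset.range m, bspline ξ q i x = 1 := by
  induction q with
  | zero =>
    intro x hx
    induction m with
    | zero => exact absurd hx (by simp)
    | succ m ihm =>
      rw [Finset.sum_range_succ]
      rcases lt_or_ge x (ξ m) with h | h
      · rw [ihm ⟨hx.1, h⟩, bspline, if_neg (by intro h'; linarith [h'.1]), add_zero]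
      · rw [Finset.sum_eq_zero, bspline, if_pos ⟨h, hx.2⟩, zero_add]
        intro i hi
        rw [bspline, if_neg]
        rintro ⟨-, h2⟩
        have : ξ (i + 1) ≤ ξ m := hξ (Finset.mem_range.1 hi)
        linarith
  | succ q ih =>
    intro x hx
    -- `τ i` is the left coefficient of the recursion. Wherever the spline of index `i + 1` is
    -- nonzero, the right coefficient is `1 - τ (i + 1)`, so the sum telescopes.
    set τ : ℕ → ℝ := fun i => (x - ξ i) / (ξ (i + q + 1) - ξ i) with hτ
    have key : ∀ i, bspline ξ (q + 1) i x =
        bspline ξ q (i + 1) x + (τ i * bspline ξ q i x - τ (i + 1) * bspline ξ q (i + 1) x) := by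
      intro i
      rw [bspline]
      by_cases h : x ∈ Ico (ξ (i + 1)) (ξ (i + 1 + q + 1))
      · have hlt : 0 < ξ (i + 1 + q + 1) - ξ (i + 1) := by linarith [h.1, h.2]
        have : (ξ (i + q + 2) - x) / (ξ (i + q + 2) - ξ (i + 1)) = 1 - τ (i + 1) := by
          rw [show i + q + 2 = i + 1 + q + 1 by ring]
          simp only [hτ]
          field_simp
          ring
        rw [this]
        simp only [hτ]
        ring
      · rw [bspline_eq_zero hξ q (i + 1) x h]
        simp [hτ]
    -- The two end terms of the telescope vanish: `x` lies to the right of the support of the spline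
    -- `0` and to the left of that of the spline `m`.
    have h0 : bspline ξ q 0 x = 0 := bspline_eq_zero hξ q 0 x fun h => by
      have := h.2
      rw [zero_add] at this
      linarith [hx.1]
    have hm : bspline ξ q m x = 0 := bspline_eq_zero hξ q m x fun h => by linarith [h.1, hx.2]
    have hs := ih x ⟨(hξ (by omega)).trans hx.1, hx.2⟩
    have hshift : ∑ i ∈ Finset.range m, bspline ξ q (i + 1) x = 1 := by
      have e1 := Finset.sum_range_succ (fun i => bspline ξ q i x) m
      have e2 := Finset.sum_range_succ' (fun i => bspline ξ q i x) m
      linarith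
    rw [Finset.sum_congr rfl fun i _ => key i, Finset.sum_add_distrib,
      Finset.sum_range_sub' (fun i => τ i * bspline ξ q i x), hshift, h0, hm]
    simp

/-- On one span the degree-zero splines are constant and the recursion multiplies by affine
functions, so the result is a polynomial. Half-open spans are used because they cover `[0, 1)`
without exception. -/
theorem exists_contDiff_bspline (hξ : Monotone ξ) (j q : ℕ) :
    ∀ i, ∃ f : ℝ → ℝ, ContDiff ℝ ∞ f ∧ EqOn (bspline ξ q i) f (Ico (ξ j) (ξ (j + 1))) := by
  induction q with
  | zero =>
    intro i
    refine ⟨fun _ => if i = j then 1 else 0, contDiff_const, fun x hx => ?_⟩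
    rw [bspline]
    rcases lt_trichotomy i j with h | h | h
    · have := hξ (show i + 1 ≤ j from h)
      rw [if_neg (by rintro ⟨-, h2⟩; linarith [hx.1]), if_neg h.ne]
    · subst h
      rw [if_pos (mem_Ico.1 hx)]
      simp
    · have := hξ (show j + 1 ≤ i from h)
      rw [if_neg (by rintro ⟨h2, -⟩; linarith [hx.2]), if_neg h.ne']
  | succ q ih =>
    intro i
    obtain ⟨f, hf, hfe⟩ := ih i
    obtain ⟨g, hg, hge⟩ := ih (i + 1)
    refine ⟨fun x => (x - ξ i) / (ξ (i + q + 1) - ξ i) * f x +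
      (ξ (i + q + 2) - x) / (ξ (i + q + 2) - ξ (i + 1)) * g x, ?_, fun x hx => ?_⟩
    · exact (((contDiff_id.sub contDiff_const).div_const _).mul hf).add
        (((contDiff_const.sub contDiff_id).div_const _).mul hg)
    · rw [bspline, hfe hx, hge hx]

end BSplines

/-! ### Functions that extend smoothly from a set -/

section SmoothOn

variable {E F : Type*} [NormedAddCommGroup E] [NormedSpace ℝ E] [NormedAddCommGroup F]
  [NormedSpace ℝ F]

/-- `f` agrees on `S` with a function that is smooth on the whole space. -/
def ExtendsSmoothly (S : Set E) (f : E → F) : Prop := ∃ g : E → F, ContDiff ℝ ∞ g ∧ EqOn f g S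

theorem ExtendsSmoothly.mono {S S' : Set E} {f : E → F} (h : ExtendsSmoothly S f) (hS : S' ⊆ S) :
    ExtendsSmoothly S' f :=
  let ⟨g, hg, he⟩ := h
  ⟨g, hg, he.mono hS⟩

theorem ExtendsSmoothly.congr {S : Set E} {f f' : E → F} (h : ExtendsSmoothly S f)
    (hf : EqOn f' f S) : ExtendsSmoothly S f' :=
  let ⟨g, hg, he⟩ := h
  ⟨g, hg, hf.trans he⟩

theorem extendsSmoothly_const (S : Set E) (c : F) : ExtendsSmoothly S fun _ => c :=
  ⟨_, contDiff_const, fun _ _ => rfl⟩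

theorem ExtendsSmoothly.add {S : Set E} {f f' : E → F} (h : ExtendsSmoothly S f)
    (h' : ExtendsSmoothly S f') : ExtendsSmoothly S fun x => f x + f' x :=
  let ⟨_, hg, he⟩ := h
  let ⟨_, hg', he'⟩ := h'
  ⟨_, hg.add hg', fun x hx => by simp [he hx, he' hx]⟩

theorem ExtendsSmoothly.smul {S : Set E} {a : E → ℝ} {f : E → F} (h : ExtendsSmoothly S a)
    (h' : ExtendsSmoothly S f) : ExtendsSmoothly S fun x => a x • f x :=
  let ⟨_, hg, he⟩ := h
  let ⟨_, hg', he'⟩ := h'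
  ⟨_, hg.smul hg', fun x hx => by simp [he hx, he' hx]⟩

theorem ExtendsSmoothly.mul {S : Set E} {f f' : E → ℝ} (h : ExtendsSmoothly S f)
    (h' : ExtendsSmoothly S f') : ExtendsSmoothly S fun x => f x * f' x :=
  h.smul h'

theorem ExtendsSmoothly.sum {ι : Type*} {S : Set E} {f : ι → E → F} {s : Finset ι}
    (h : ∀ i ∈ s, ExtendsSmoothly S (f i)) : ExtendsSmoothly S fun x => ∑ i ∈ s, f i x := by
  classical
  induction s using Finset.induction_on with
  | empty => simpa using extendsSmoothly_const S (0 : F)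
  | insert a s ha ih =>
    simp only [Finset.sum_insert ha]
    exact (h a (by simp)).add (ih fun i hi => h i (by simp [hi]))

theorem ExtendsSmoothly.prod {ι : Type*} {S : Set E} {f : ι → E → ℝ} {s : Finset ι}
    (h : ∀ i ∈ s, ExtendsSmoothly S (f i)) : ExtendsSmoothly S fun x => ∏ i ∈ s, f i x := by
  classical
  induction s using Finset.induction_on with
  | empty => simpa using extendsSmoothly_const S (1 : ℝ)
  | insert a s ha ih =>
    simp only [Finset.prod_insert ha]
    exact (h a (by simp)).mul (ih fun i hi => h i (by simp [hi]))

theorem exists_contDiff_eq_inv {c : ℝ} (hc : 0 < c) :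
    ∃ f : ℝ → ℝ, ContDiff ℝ ∞ f ∧ ∀ x, c ≤ x → f x = x⁻¹ := by
  -- The argument `2 / c * x - 1` is `0` at `c / 2` and `1` at `c`: the cut-off removes the
  -- singularity at `0` and leaves `x⁻¹` untouched on `[c, ∞)`.
  refine ⟨fun x => Real.smoothTransition (2 / c * x - 1) * x⁻¹, ?_, fun x hx => ?_⟩
  · rw [contDiff_iff_contDiffAt]
    intro x
    rcases lt_or_ge x (c / 2) with h | h
    · refine (contDiffAt_const (c := (0 : ℝ))).congr_of_eventuallyEq ?_
      filter_upwards [Iio_mem_nhds h] with y hy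
      rw [Real.smoothTransition.zero_of_nonpos, zero_mul]
      have : 2 / c * y ≤ 2 / c * (c / 2) := by gcongr; exact le_of_lt hy
      have h2 : 2 / c * (c / 2) = 1 := by field_simp
      linarith
    · have hx : x ≠ 0 := by linarith
      refine ContDiffAt.mul ?_ (contDiffAt_id.inv hx)
      exact (Real.smoothTransition.contDiff.comp
        ((contDiff_const.mul contDiff_id).sub contDiff_const)).contDiffAt
  · show Real.smoothTransition (2 / c * x - 1) * x⁻¹ = x⁻¹
    rw [Real.smoothTransition.one_of_one_le, one_mul]
    have : 2 / c * c ≤ 2 / c * x := by gcongr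
    have h2 : 2 / c * c = 2 := by field_simp
    linarith

theorem ExtendsSmoothly.inv {S : Set E} {f : E → ℝ} {c : ℝ} (hc : 0 < c)
    (h : ExtendsSmoothly S f) (hf : ∀ x ∈ S, c ≤ f x) : ExtendsSmoothly S fun x => (f x)⁻¹ := by
  obtain ⟨g, hg, he⟩ := h
  obtain ⟨r, hr, hre⟩ := exists_contDiff_eq_inv hc
  exact ⟨_, hr.comp hg, fun x hx => by simp only [Function.comp, ← he hx, hre _ (hf x hx)]⟩

end SmoothOn

/-! ### Tensor-product splines and NURBS on a knot span -/

section Tensor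

variable {d p : ℕ}

/-- The half-open knot span with index `j`. -/
def halfOpenBox (Ξ : Fin (d + 1) → OpenKnotVector p) (j : Fin (d + 1) → ℕ) :
    Set (Fin (d + 1) → ℝ) :=
  Set.pi univ fun α => Ico ((Ξ α).knot (j α)) ((Ξ α).knot (j α + 1))

theorem cellBox_subset_halfOpenBox (Ξ : Fin (d + 1) → OpenKnotVector p) (j : Fin (d + 1) → ℕ) :
    cellBox Ξ j ⊆ halfOpenBox Ξ j :=
  Set.pi_mono fun _ _ => Ioo_subset_Ico_self

theorem OpenKnotVector.lt_n (Ξ : OpenKnotVector p) : p < Ξ.n := by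
  by_contra h
  have h0 := Ξ.knot_first p le_rfl
  have h1 := Ξ.knot_last p (by omega) (by omega)
  linarith

theorem OpenKnotVector.knot_n (Ξ : OpenKnotVector p) : Ξ.knot Ξ.n = 1 :=
  Ξ.knot_last _ le_rfl (by omega)

theorem OpenKnotVector.knot_nonneg (Ξ : OpenKnotVector p) (i : ℕ) : 0 ≤ Ξ.knot i := by
  rw [← Ξ.knot_first 0 (by omega)]
  exact Ξ.mono (by omega)

theorem OpenKnotVector.knot_le_one (Ξ : OpenKnotVector p) {i : ℕ} (hi : i ≤ Ξ.n) :
    Ξ.knot i ≤ 1 := by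
  rw [← Ξ.knot_n]
  exact Ξ.mono hi

theorem OpenKnotVector.sum_bspline (Ξ : OpenKnotVector p) {x : ℝ} (hx : x ∈ Ico (0 : ℝ) 1) :
    ∑ i ∈ Finset.range Ξ.n, bspline Ξ.knot p i x = 1 := by
  apply SpaceTimeIgA.sum_bspline Ξ.mono
  rwa [Ξ.knot_first p le_rfl, Ξ.knot_n]

theorem sum_tbspline (Ξ : Fin (d + 1) → OpenKnotVector p) {x : Fin (d + 1) → ℝ}
    (hx : ∀ α, x α ∈ Ico (0 : ℝ) 1) : ∑ i ∈ basisIdx Ξ, tbspline Ξ i x = 1 := by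
  simp only [tbspline, basisIdx]
  rw [← Finset.prod_univ_sum (fun α => Finset.range (Ξ α).n)
    fun α k => bspline (Ξ α).knot p k (x α)]
  exact Finset.prod_eq_one fun α _ => (Ξ α).sum_bspline (hx α)

theorem tbspline_nonneg (Ξ : Fin (d + 1) → OpenKnotVector p) (i : Fin (d + 1) → ℕ)
    (x : Fin (d + 1) → ℝ) : 0 ≤ tbspline Ξ i x :=
  Finset.prod_nonneg fun α _ => bspline_nonneg (Ξ α).mono _ _ _

/-- By the partition of unity the weighting function is a convex combination of the weights, hence
at least the smallest one. -/
theorem IsWeight.exists_le_weightFun {Ξ : Fin (d + 1) → OpenKnotVector p}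
    {w : (Fin (d + 1) → ℕ) → ℝ} (hw : IsWeight Ξ w) :
    ∃ c > 0, ∀ x : Fin (d + 1) → ℝ, (∀ α, x α ∈ Ico (0 : ℝ) 1) → c ≤ weightFun Ξ w x := by
  have hne : (basisIdx Ξ).Nonempty := by
    refine ⟨fun _ => 0, Fintype.mem_piFinset.2 fun α => Finset.mem_range.2 ?_⟩
    have := (Ξ α).lt_n
    omega
  obtain ⟨i₀, hi₀, hmin⟩ := Finset.exists_min_image _ w hne
  refine ⟨w i₀, hw.1 i₀ hi₀, fun x hx => ?_⟩
  calc w i₀ = ∑ i ∈ basisIdx Ξ, w i₀ * tbspline Ξ i x := by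
        rw [← Finset.mul_sum, sum_tbspline Ξ hx, mul_one]
    _ ≤ weightFun Ξ w x := Finset.sum_le_sum fun i hi =>
        mul_le_mul_of_nonneg_right (hmin i hi) (tbspline_nonneg Ξ i x)

theorem extendsSmoothly_tbspline (Ξ : Fin (d + 1) → OpenKnotVector p) (j i : Fin (d + 1) → ℕ) :
    ExtendsSmoothly (halfOpenBox Ξ j) (tbspline Ξ i) := by
  refine ExtendsSmoothly.prod 
    (f := fun α (x : Fin (d + 1) → ℝ) => bspline (Ξ α).knot p (i α) (x α)) fun α _ => ?_
  obtain ⟨f, hf, he⟩ := exists_contDiff_bspline (Ξ α).mono (j α) p (i α)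
  exact ⟨fun x => f (x α), hf.comp (contDiff_apply ℝ ℝ α), fun x hx => he (hx α trivial)⟩

theorem extendsSmoothly_weightFun (Ξ : Fin (d + 1) → OpenKnotVector p)
    (w : (Fin (d + 1) → ℕ) → ℝ) (j : Fin (d + 1) → ℕ) :
    ExtendsSmoothly (halfOpenBox Ξ j) (weightFun Ξ w) :=
  ExtendsSmoothly.sum fun i _ => (extendsSmoothly_const _ _).mul (extendsSmoothly_tbspline Ξ j i)

theorem mem_Ico_of_mem_halfOpenBox {Ξ : Fin (d + 1) → OpenKnotVector p} {j : Fin (d + 1) → ℕ}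
    (hj : j ∈ basisIdx Ξ) {x : Fin (d + 1) → ℝ} (hx : x ∈ halfOpenBox Ξ j) (α : Fin (d + 1)) :
    x α ∈ Ico (0 : ℝ) 1 := by
  have h := hx α trivial
  have hjα := Finset.mem_range.1 (Fintype.mem_piFinset.1 hj α)
  exact ⟨((Ξ α).knot_nonneg _).trans h.1, h.2.trans_le ((Ξ α).knot_le_one hjα)⟩

theorem IsWeight.extendsSmoothly_inv {Ξ : Fin (d + 1) → OpenKnotVector p}
    {w : (Fin (d + 1) → ℕ) → ℝ} (hw : IsWeight Ξ w) {j : Fin (d + 1) → ℕ} (hj : j ∈ basisIdx Ξ) :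
    ExtendsSmoothly (halfOpenBox Ξ j) fun x => (weightFun Ξ w x)⁻¹ := by
  obtain ⟨c, hc, hle⟩ := hw.exists_le_weightFun
  exact (extendsSmoothly_weightFun Ξ w j).inv hc fun x hx =>
    hle x (mem_Ico_of_mem_halfOpenBox hj hx)

theorem IsWeight.extendsSmoothly_geoMap {Ξ : Fin (d + 1) → OpenKnotVector p}
    {w : (Fin (d + 1) → ℕ) → ℝ} (hw : IsWeight Ξ w) {j : Fin (d + 1) → ℕ} (hj : j ∈ basisIdx Ξ)
    (P : (Fin (d + 1) → ℕ) → SpT d) : ExtendsSmoothly (halfOpenBox Ξ j) (geoMap Ξ w P) := by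
  refine ExtendsSmoothly.sum fun i _ => ExtendsSmoothly.smul ?_ (extendsSmoothly_const _ _)
  unfold nurbs
  simp only [div_eq_mul_inv]
  exact ((extendsSmoothly_const _ _).mul (extendsSmoothly_tbspline Ξ j i)).mul
    (hw.extendsSmoothly_inv hj)

/-- The span ends at the first knot with positive index beyond `x`; minimality puts its left end at
or before `x`, even when knots are repeated. -/
theorem exists_mem_Ico_knot (Ξ : OpenKnotVector p) {x : ℝ} (hx : x ∈ Ico (0 : ℝ) 1) :
    ∃ j < Ξ.n, x ∈ Ico (Ξ.knot j) (Ξ.knot (j + 1)) := by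
  have hex : ∃ j, x < Ξ.knot (j + 1) := by
    refine ⟨Ξ.n, hx.2.trans_le ?_⟩
    rw [← Ξ.knot_n]
    exact Ξ.mono (by omega)
  classical
  refine ⟨Nat.find hex, ?_, ?_, Nat.find_spec hex⟩
  · have hn := Ξ.lt_n
    have : Nat.find hex ≤ Ξ.n - 1 := Nat.find_min' hex (by
      rw [Nat.sub_add_cancel (by omega), Ξ.knot_n]
      exact hx.2)
    omega
  · rcases h : Nat.find hex with _ | k
    · rw [Ξ.knot_first 0 (by omega)]
      exact hx.1
    · exact not_lt.1 (Nat.find_min hex (m := k) (by omega))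

theorem exists_mem_halfOpenBox (Ξ : Fin (d + 1) → OpenKnotVector p) {x : Fin (d + 1) → ℝ}
    (hx : ∀ α, x α ∈ Ico (0 : ℝ) 1) : ∃ j ∈ basisIdx Ξ, x ∈ halfOpenBox Ξ j := by
  choose j hj hjx using fun α => exists_mem_Ico_knot (Ξ α) (hx α)
  exact ⟨j, Fintype.mem_piFinset.2 fun α => Finset.mem_range.2 (hj α), fun α _ => hjx α⟩

end Tensor

/-! ### Hierarchical meshes -/

section Mesh

variable {d p : ℕ}

theorem isOpen_cellBox (Ξ : Fin (d + 1) → OpenKnotVector p) (j : Fin (d + 1) → ℕ) :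
    IsOpen (cellBox Ξ j) :=
  isOpen_set_pi finite_univ fun _ _ => isOpen_Ioo

theorem mem_cells {Ξ : Fin (d + 1) → OpenKnotVector p} {j : Fin (d + 1) → ℕ} :
    j ∈ cells Ξ ↔ j ∈ basisIdx Ξ ∧ ∀ α, (Ξ α).knot (j α) < (Ξ α).knot (j α + 1) := by
  simp [cells]

theorem cellBox_nonempty {Ξ : Fin (d + 1) → OpenKnotVector p} {j : Fin (d + 1) → ℕ}
    (hj : j ∈ cells Ξ) : (cellBox Ξ j).Nonempty :=
  univ_pi_nonempty_iff.2 fun α => nonempty_Ioo.2 ((mem_cells.1 hj).2 α)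

theorem cellBox_subset_parDomain {Ξ : Fin (d + 1) → OpenKnotVector p} {j : Fin (d + 1) → ℕ}
    (hj : j ∈ basisIdx Ξ) : cellBox Ξ j ⊆ parDomain d := fun x hx α _ => by
  have hjα := Finset.mem_range.1 (Fintype.mem_piFinset.1 hj α)
  exact ⟨((Ξ α).knot_nonneg _).trans_lt (hx α trivial).1,
    (hx α trivial).2.trans_le ((Ξ α).knot_le_one hjα)⟩

theorem closure_cellBox_subset (Ξ : Fin (d + 1) → OpenKnotVector p) (j : Fin (d + 1) → ℕ) :
    closure (cellBox Ξ j) ⊆ Set.pi univ fun α => Icc ((Ξ α).knot (j α)) ((Ξ α).knot (j α + 1)) :=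
  closure_minimal (Set.pi_mono fun _ _ => Ioo_subset_Icc_self)
    (isClosed_set_pi fun _ _ => isClosed_Icc)

theorem eq_of_mem_cellBox {Ξ : Fin (d + 1) → OpenKnotVector p} {j j' : Fin (d + 1) → ℕ}
    {x : Fin (d + 1) → ℝ} (hx : x ∈ cellBox Ξ j) (hx' : x ∈ cellBox Ξ j') : j = j' := by
  funext α
  have h := hx α trivial
  have h' := hx' α trivial
  rcases lt_trichotomy (j α) (j' α) with hlt | heq | hlt
  · have := (Ξ α).mono (show j α + 1 ≤ j' α from hlt)
    linarith [h.2, h'.1]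
  · exact heq
  · have := (Ξ α).mono (show j' α + 1 ≤ j α from hlt)
    linarith [h.1, h'.2]

theorem OpenKnotVector.mult_pos_iff {Ξ : OpenKnotVector p} {x : ℝ} :
    0 < Ξ.mult x ↔ ∃ k < Ξ.n + p + 1, Ξ.knot k = x := by
  simp [OpenKnotVector.mult, Finset.card_pos, Finset.Nonempty, Finset.mem_filter]

theorem Hierarchy.mult_mono (H : Hierarchy d p) {ℓ ℓ' : ℕ} (h : ℓ ≤ ℓ') (hL : ℓ' ≤ H.L)
    (α : Fin (d + 1)) (x : ℝ) : (H.Ξ ℓ α).mult x ≤ (H.Ξ ℓ' α).mult x := by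
  induction ℓ', h using Nat.le_induction with
  | base => exact le_rfl
  | succ k _ ih => exact (ih (by omega)).trans (H.nested k (by omega) α x)

/-- A cell of a finer level that meets a closed cell of a coarser level is contained in it. -/
theorem Hierarchy.cellBox_subset (H : Hierarchy d p) {ℓ ℓ' : ℕ} (h : ℓ ≤ ℓ') (hL : ℓ' ≤ H.L)
    {j j' : Fin (d + 1) → ℕ} (hj : j ∈ basisIdx (H.Ξ ℓ)) {x : Fin (d + 1) → ℝ}
    (hx' : x ∈ cellBox (H.Ξ ℓ') j')
    (hx : ∀ α, x α ∈ Icc ((H.Ξ ℓ α).knot (j α)) ((H.Ξ ℓ α).knot (j α + 1))) :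
    cellBox (H.Ξ ℓ') j' ⊆ cellBox (H.Ξ ℓ) j := by
  refine Set.pi_mono fun α _ => ?_
  have hjα := Finset.mem_range.1 (Fintype.mem_piFinset.1 hj α)
  have hxα := hx' α trivial
  -- Nested multiplicities make every coarse knot a fine knot, so none lies strictly inside a fine
  -- span.
  have knot : ∀ k < (H.Ξ ℓ α).n + p + 1, (H.Ξ ℓ α).knot k ≤ (H.Ξ ℓ' α).knot (j' α) ∨
      (H.Ξ ℓ' α).knot (j' α + 1) ≤ (H.Ξ ℓ α).knot k := by
    intro k hk
    obtain ⟨m, -, hm⟩ := OpenKnotVector.mult_pos_iff.1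
      ((OpenKnotVector.mult_pos_iff.2 ⟨k, hk, rfl⟩).trans_le (H.mult_mono h hL α _))
    rw [← hm]
    rcases Nat.lt_or_ge (j' α) m with h' | h'
    · exact Or.inr ((H.Ξ ℓ' α).mono h')
    · exact Or.inl ((H.Ξ ℓ' α).mono h')
  apply Ioo_subset_Ioo
  · rcases knot (j α) (by omega) with h' | h'
    · exact h'
    · linarith [(hx α).1, hxα.2]
  · rcases knot (j α + 1) (by omega) with h' | h'
    · linarith [(hx α).2, hxα.1]
    · exact h'

theorem Hierarchy.region_antitone (H : Hierarchy d p) : Antitone H.region :=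
  antitone_nat_of_succ_le H.subdomain_anti

theorem Hierarchy.mem_region_succ {H : Hierarchy d p} {ℓ : ℕ} {x : Fin (d + 1) → ℝ} :
    x ∈ H.region (ℓ + 1) ↔ ∃ j ∈ H.refined ℓ, x ∈ closure (cellBox (H.Ξ ℓ) j) := by
  simp [Hierarchy.region, subdomain]

theorem Hierarchy.mem_parMesh {H : Hierarchy d p} {B : Set (Fin (d + 1) → ℝ)} :
    B ∈ H.parMesh ↔ ∃ ℓ ≤ H.L, ∃ j ∈ cells (H.Ξ ℓ), cellBox (H.Ξ ℓ) j = B ∧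
      B ⊆ H.region ℓ ∧ ¬ B ⊆ H.region (ℓ + 1) := by
  simp only [Hierarchy.parMesh, Finset.mem_biUnion, Finset.mem_range, Finset.mem_filter,
    Finset.mem_image, Nat.lt_succ_iff]
  constructor
  · rintro ⟨ℓ, h, ⟨j, hj, rfl⟩, h'⟩
    exact ⟨ℓ, h, j, hj, rfl, h'⟩
  · rintro ⟨ℓ, h, j, hj, rfl, h'⟩
    exact ⟨ℓ, h, ⟨j, hj, rfl⟩, h'⟩

/-- The next region consists of closed cells of the same level. An open cell that meets one of them
meets its interior, hence is that cell. -/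
theorem Hierarchy.disjoint_region_succ (H : Hierarchy d p) {ℓ : ℕ} {j : Fin (d + 1) → ℕ}
    (h : ¬ cellBox (H.Ξ ℓ) j ⊆ H.region (ℓ + 1)) :
    Disjoint (cellBox (H.Ξ ℓ) j) (H.region (ℓ + 1)) := by
  rw [Set.disjoint_left]
  intro x hx hxr
  obtain ⟨j', hj', hxj'⟩ := Hierarchy.mem_region_succ.1 hxr
  obtain ⟨y, hy, hy'⟩ := mem_closure_iff.1 hxj' _ (isOpen_cellBox _ _) hx
  obtain rfl := eq_of_mem_cellBox hy hy'
  exact h fun z hz => Hierarchy.mem_region_succ.2 ⟨j, hj', subset_closure hz⟩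

theorem Hierarchy.parMesh_isOpen {H : Hierarchy d p} {B : Set (Fin (d + 1) → ℝ)}
    (hB : B ∈ H.parMesh) : IsOpen B := by
  obtain ⟨ℓ, -, j, -, rfl, -⟩ := Hierarchy.mem_parMesh.1 hB
  exact isOpen_cellBox _ _

theorem Hierarchy.parMesh_subset {H : Hierarchy d p} {B : Set (Fin (d + 1) → ℝ)}
    (hB : B ∈ H.parMesh) : B ⊆ parDomain d := by
  obtain ⟨ℓ, -, j, hj, rfl, -⟩ := Hierarchy.mem_parMesh.1 hB
  exact cellBox_subset_parDomain (mem_cells.1 hj).1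

/-- For cells of different levels, the finer one lies in its own region, hence in the region
following the level of the coarser cell, which the coarser cell avoids. -/
theorem Hierarchy.parMesh_pairwiseDisjoint (H : Hierarchy d p) {B B' : Set (Fin (d + 1) → ℝ)}
    (hB : B ∈ H.parMesh) (hB' : B' ∈ H.parMesh) (hne : B ≠ B') : Disjoint B B' := by
  obtain ⟨ℓ, -, j, hj, rfl, hr, hr'⟩ := Hierarchy.mem_parMesh.1 hB
  obtain ⟨m, -, k, hk, rfl, hs, hs'⟩ := Hierarchy.mem_parMesh.1 hB'
  rcases lt_trichotomy ℓ m with h | rfl | h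
  · exact (H.disjoint_region_succ hr').mono_right (hs.trans (H.region_antitone h))
  · rw [Set.disjoint_left]
    intro x hx hx'
    rw [eq_of_mem_cellBox hx hx'] at hne
    exact hne rfl
  · exact ((H.disjoint_region_succ hs').mono_right (hr.trans (H.region_antitone h))).symm

theorem mem_Ico_of_mem_parDomain {x : Fin (d + 1) → ℝ} (hx : x ∈ parDomain d) (α : Fin (d + 1)) :
    x α ∈ Ico (0 : ℝ) 1 :=
  Ioo_subset_Ico_self (hx α trivial)

/-- The mesh covers the parameter domain up to the knot hyperplanes. -/
theorem Hierarchy.exists_mem_parMesh (H : Hierarchy d p) {x : Fin (d + 1) → ℝ}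
    (hx : x ∈ parDomain d) (hk : ∀ ℓ ≤ H.L, ∀ α, ∀ k < (H.Ξ ℓ α).n, (H.Ξ ℓ α).knot k ≠ x α) :
    ∃ B ∈ H.parMesh, x ∈ B := by
  classical
  have hx0 : x ∈ H.region 0 :=
    ⟨fun α => (hx α trivial).1.le, fun α => (hx α trivial).2.le⟩
  -- The cell is sought on the deepest level whose region contains `x`. The region of level `L + 1`
  -- is empty, so `x` is never in the next one.
  set ℓ := Nat.findGreatest (fun ℓ => x ∈ H.region ℓ) H.L with hℓ
  have hℓL : ℓ ≤ H.L := Nat.findGreatest_le _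
  have hxℓ : x ∈ H.region ℓ :=
    Nat.findGreatest_spec (P := fun ℓ => x ∈ H.region ℓ) (Nat.zero_le _) hx0
  have hxs : x ∉ H.region (ℓ + 1) := by
    rcases hℓL.lt_or_eq with h | h
    · exact Nat.findGreatest_is_greatest (P := fun ℓ => x ∈ H.region ℓ) (Nat.lt_succ_self _) h
    · rw [Hierarchy.mem_region_succ, h, H.refined_top _ le_rfl]
      simp
  obtain ⟨j, hj, hxj⟩ := exists_mem_halfOpenBox (H.Ξ ℓ) (mem_Ico_of_mem_parDomain hx)
  have hxc : x ∈ cellBox (H.Ξ ℓ) j := fun α _ =>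
    ⟨lt_of_le_of_ne (hxj α trivial).1
      (hk ℓ hℓL α (j α) (Finset.mem_range.1 (Fintype.mem_piFinset.1 hj α))), (hxj α trivial).2⟩
  refine ⟨_, Hierarchy.mem_parMesh.2 ⟨ℓ, hℓL, j, mem_cells.2 ⟨hj, fun α => ?_⟩, rfl, ?_,
    fun h => hxs (h hxc)⟩, hxc⟩
  · exact (hxc α trivial).1.trans (hxc α trivial).2
  · rcases hm : ℓ with _ | m
    · rw [hm] at hj
      intro y hy
      have hy' := cellBox_subset_parDomain hj hy
      exact ⟨fun α => (hy' α trivial).1.le, fun α => (hy' α trivial).2.le⟩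
    -- On a positive level `x` lies in a closed refined cell of the previous level, and by
    -- nestedness the whole cell around `x` lies in it too.
    · rw [hm] at hxℓ hxc
      obtain ⟨k, hk', hxk⟩ := Hierarchy.mem_region_succ.1 hxℓ
      refine (H.cellBox_subset (Nat.le_succ m) (by omega)
        (mem_cells.1 (H.refined_subset m hk')).1 hxc
        fun α => closure_cellBox_subset _ _ hxk α trivial).trans fun y hy => ?_
      exact Hierarchy.mem_region_succ.2 ⟨k, hk', subset_closure hy⟩

/-- A cell of the mesh lies in a single knot span of each coarser level. -/
theorem Hierarchy.exists_subset_halfOpenBox (H : Hierarchy d p) {ℓ m : ℕ} (h : m ≤ ℓ)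
    (hL : ℓ ≤ H.L) {j : Fin (d + 1) → ℕ} (hj : j ∈ cells (H.Ξ ℓ)) :
    ∃ k ∈ basisIdx (H.Ξ m), cellBox (H.Ξ ℓ) j ⊆ halfOpenBox (H.Ξ m) k := by
  obtain ⟨x, hx⟩ := cellBox_nonempty hj
  obtain ⟨k, hk, hxk⟩ := exists_mem_halfOpenBox (H.Ξ m) (mem_Ico_of_mem_parDomain
    (cellBox_subset_parDomain (mem_cells.1 hj).1 hx))
  exact ⟨k, hk, (H.cellBox_subset h hL hk hx fun α => Ico_subset_Icc_self (hxk α trivial)).trans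
    (cellBox_subset_halfOpenBox _ _)⟩

theorem Hierarchy.exists_parMesh_subset_halfOpenBox {H : Hierarchy d p}
    {B : Set (Fin (d + 1) → ℝ)} (hB : B ∈ H.parMesh) :
    ∃ k ∈ basisIdx (H.Ξ 0), B ⊆ halfOpenBox (H.Ξ 0) k := by
  obtain ⟨ℓ, hℓ, j, hj, rfl, -⟩ := Hierarchy.mem_parMesh.1 hB
  exact H.exists_subset_halfOpenBox (Nat.zero_le _) hℓ hj

/-- A spline of the same or a coarser level sees the element inside a single one of its spans. A
spline of a finer level is supported in the next region and so vanishes on the element. -/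
theorem Hierarchy.extendsSmoothly_basis {H : Hierarchy d p} {B : Set (Fin (d + 1) → ℝ)}
    (hB : B ∈ H.parMesh) {β : (Fin (d + 1) → ℝ) → ℝ} (hβ : β ∈ H.basis) :
    ExtendsSmoothly B β := by
  have hBp := Hierarchy.parMesh_subset hB
  obtain ⟨ℓ, hℓ, j, hj, rfl, -, hr⟩ := Hierarchy.mem_parMesh.1 hB
  obtain ⟨m, -, i, -, rfl, hs, -⟩ := hβ
  rcases le_or_gt m ℓ with h | h
  · obtain ⟨k, -, hk⟩ := H.exists_subset_halfOpenBox h hℓ hj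
    exact (extendsSmoothly_tbspline (H.Ξ m) k i).mono hk
  · refine (extendsSmoothly_const _ 0).congr fun x hx => ?_
    by_contra hne
    exact Set.disjoint_left.1 (H.disjoint_region_succ hr) hx
      (H.region_antitone h (hs ⟨hBp hx, hne⟩))

end Mesh

/-! ### The physical mesh -/

section PhysicalMesh

variable {d p : ℕ} {H : Hierarchy d p} {w κ : (Fin (d + 1) → ℕ) → ℝ}
  {P : (Fin (d + 1) → ℕ) → SpT d} {Q K : Set (SpT d)}

theorem finrank_spT (d : ℕ) :
    Module.finrank ℝ (SpT d) = Module.finrank ℝ (Fin (d + 1) → ℝ) := by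
  simp

theorem mem_physMesh {Φ : (Fin (d + 1) → ℝ) → SpT d} :
    K ∈ physMesh H Φ ↔ ∃ B ∈ H.parMesh, Φ '' B = K := by
  simp [physMesh]

/-- The smooth left inverse makes the derivative of the geometry map injective at each point of the
cell; equal dimensions make it surjective, so the map is locally open. -/
theorem isOpen_of_mem_physMesh (hw : IsWeight (H.Ξ 0) w)
    (hΦ : IsRegularMap H (geoMap (H.Ξ 0) w P) Q) (hK : K ∈ physMesh H (geoMap (H.Ξ 0) w P)) :
    IsOpen K := by
  obtain ⟨B, hB, rfl⟩ := mem_physMesh.1 hK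
  have hBo := Hierarchy.parMesh_isOpen hB
  obtain ⟨k, hk, hBk⟩ := Hierarchy.exists_parMesh_subset_halfOpenBox hB
  obtain ⟨Ψ, hΨ, he⟩ := (hw.extendsSmoothly_geoMap hk P).mono hBk
  obtain ⟨G, hG, hGe⟩ := hΦ.2 B hB
  rw [he.image_eq, isOpen_iff_mem_nhds]
  rintro _ ⟨ξ, hξ, rfl⟩
  have hΨd : HasStrictFDerivAt Ψ (fderiv ℝ Ψ ξ) ξ := hΨ.contDiffAt.hasStrictFDerivAt (by simp)
  have hGd : HasFDerivAt G (fderiv ℝ G (Ψ ξ)) (Ψ ξ) :=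
    (hG.differentiable (by simp)).differentiableAt.hasFDerivAt
  have hcomp := hGd.comp ξ hΨd.hasFDerivAt
  have hid : HasFDerivAt (G ∘ Ψ) (ContinuousLinearMap.id ℝ (Fin (d + 1) → ℝ)) ξ := by
    refine (hasFDerivAt_id ξ).congr_of_eventuallyEq ?_
    filter_upwards [hBo.mem_nhds hξ] with η hη
    rw [Function.comp, ← he hη, hGe η hη, id]
  have hinj : Function.Injective (fderiv ℝ Ψ ξ : (Fin (d + 1) → ℝ) →ₗ[ℝ] SpT d) := by
    intro a b hab
    have hu := hcomp.unique hid
    have ha := congrArg (fun L => L a) hu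
    have hb := congrArg (fun L => L b) hu
    simp only [ContinuousLinearMap.comp_apply, ContinuousLinearMap.id_apply] at ha hb
    rw [← ha, ← hb]
    exact congrArg _ hab
  have hsurj := (LinearMap.injective_iff_surjective_of_finrank_eq_finrank (finrank_spT d).symm).1
    hinj
  rw [← hΨd.map_nhds_eq_of_surj (LinearMap.range_eq_top.2 hsurj)]
  exact image_mem_map (hBo.mem_nhds hξ)

theorem subset_of_mem_physMesh {Φ : (Fin (d + 1) → ℝ) → SpT d} (hΦ : IsRegularMap H Φ Q)
    (hK : K ∈ physMesh H Φ) : K ⊆ Q := by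
  obtain ⟨B, hB, rfl⟩ := mem_physMesh.1 hK
  rw [← hΦ.1.image_eq]
  exact image_mono (Hierarchy.parMesh_subset hB)

theorem physMesh_pairwiseDisjoint {Φ : (Fin (d + 1) → ℝ) → SpT d} (hΦ : IsRegularMap H Φ Q) :
    (physMesh H Φ : Set (Set (SpT d))).Pairwise (Function.onFun Disjoint id) := by
  intro K hK K' hK' hne
  obtain ⟨B, hB, rfl⟩ := mem_physMesh.1 hK
  obtain ⟨B', hB', rfl⟩ := mem_physMesh.1 hK'
  have h := H.parMesh_pairwiseDisjoint hB hB' fun h => hne (h ▸ rfl)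
  rw [Function.onFun, id, id, Set.disjoint_left]
  rintro _ ⟨x, hx, rfl⟩ ⟨y, hy, hxy⟩
  obtain rfl :=
    hΦ.1.injOn (Hierarchy.parMesh_subset hB' hy) (Hierarchy.parMesh_subset hB hx) hxy
  exact Set.disjoint_left.1 h hx hy

/-- On an element the set-theoretic inverse `invFunOn` coincides with the globally smooth `G`, so a
smooth extension in the parameter domain composed with `G` extends the discrete function. -/
theorem extendsSmoothly_of_mem_Vh (hκ : IsWeight (H.Ξ 0) κ)
    {Φ : (Fin (d + 1) → ℝ) → SpT d} (hΦ : IsRegularMap H Φ Q) (hK : K ∈ physMesh H Φ)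
    {v : SpT d → ℝ} (hv : v ∈ Vh H κ Φ) : ExtendsSmoothly K v := by
  obtain ⟨B, hB, rfl⟩ := mem_physMesh.1 hK
  obtain ⟨k, hk, hBk⟩ := Hierarchy.exists_parMesh_subset_halfOpenBox hB
  obtain ⟨G, hG, hGe⟩ := hΦ.2 B hB
  induction hv using Submodule.span_induction with
  | mem v hv =>
    obtain ⟨β, hβ, rfl⟩ := hv
    obtain ⟨g, hg, hge⟩ := (Hierarchy.extendsSmoothly_basis hB hβ).mul
      ((hκ.extendsSmoothly_inv hk).mono hBk)
    refine ⟨g ∘ G, hg.comp hG, ?_⟩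
    rintro _ ⟨ξ, hξ, rfl⟩
    have hinv : Function.invFunOn Φ (parDomain d) (Φ ξ) = ξ :=
      hΦ.1.injOn.leftInvOn_invFunOn (Hierarchy.parMesh_subset hB hξ)
    simp only [Function.comp, hinv, hGe ξ hξ, ← hge hξ, div_eq_mul_inv]
  | zero => exact extendsSmoothly_const _ 0
  | add v v' _ _ hv hv' => exact hv.add hv'
  | smul a v _ hv => exact (extendsSmoothly_const _ a).smul hv

theorem volume_image_eq_zero {Ψ : (Fin (d + 1) → ℝ) → SpT d} {N S : Set (Fin (d + 1) → ℝ)}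
    (h : ExtendsSmoothly S Ψ) (hN : volume N = 0) (hNS : N ⊆ S) : volume (Ψ '' N) = 0 := by
  obtain ⟨g, hg, he⟩ := h
  rw [(he.mono hNS).image_eq]
  -- The null-image theorem concerns maps of a space to itself; a linear isomorphism, which
  -- preserves null sets, identifies the two spaces.
  let e : SpT d ≃L[ℝ] (Fin (d + 1) → ℝ) := ContinuousLinearEquiv.ofFinrankEq (finrank_spT d)
  have hN' : volume (e ⁻¹' N) = 0 := by
    obtain ⟨c, -, hc⟩ := LinearMap.exists_map_addHaar_eq_smul_addHaar
      (L := (e : SpT d →ₗ[ℝ] (Fin (d + 1) → ℝ))) (volume : Measure (SpT d))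
      (volume : Measure (Fin (d + 1) → ℝ)) e.surjective
    have := (e.toHomeomorph.toMeasurableEquiv.map_apply (μ := (volume : Measure (SpT d))) N)
    refine this.symm.trans ?_
    change (volume : Measure (SpT d)).map e N = 0
    have hc' : (volume : Measure (SpT d)).map e = c • volume := hc
    rw [hc', Measure.smul_apply, hN, smul_zero]
  have himg : g '' N = (g ∘ e) '' (e ⁻¹' N) := by
    rw [image_comp, image_preimage_eq _ e.surjective]
  rw [himg]
  exact addHaar_image_eq_zero_of_differentiableOn_of_addHaar_eq_zero _
    ((hg.comp e.contDiff).differentiable (by simp)).differentiableOn hN'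

/-- Uncovered points come from knot hyperplanes. These are cut by the half-open spans of the
coarsest level, since the geometry map extends smoothly only from each span separately. -/
theorem volume_diff_physMesh (hw : IsWeight (H.Ξ 0) w)
    (hΦ : IsRegularMap H (geoMap (H.Ξ 0) w P) Q) :
    volume (Q \ ⋃ K ∈ physMesh H (geoMap (H.Ξ 0) w P), K) = 0 := by
  set Φ := geoMap (H.Ξ 0) w P with hΦdef
  set N : Set (Fin (d + 1) → ℝ) := ⋃ ℓ ∈ Finset.range (H.L + 1), ⋃ α : Fin (d + 1),
    ⋃ k ∈ Finset.range (H.Ξ ℓ α).n, {x | x α = (H.Ξ ℓ α).knot k} with hN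
  have hN0 : volume N = 0 := by
    refine (measure_biUnion_null_iff (Finset.countable_toSet _)).2 fun ℓ _ =>
      measure_iUnion_null_iff.2 fun α =>
        (measure_biUnion_null_iff (Finset.countable_toSet _)).2 fun k _ => ?_
    exact Measure.pi_hyperplane _ α _
  have hsub : Q \ ⋃ K ∈ physMesh H Φ, K ⊆
      ⋃ j ∈ basisIdx (H.Ξ 0), Φ '' (N ∩ halfOpenBox (H.Ξ 0) j) := by
    rintro z ⟨hz, hzK⟩
    rw [← hΦ.1.image_eq] at hz
    obtain ⟨x, hx, rfl⟩ := hz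
    obtain ⟨j, hj, hxj⟩ := exists_mem_halfOpenBox (H.Ξ 0) (mem_Ico_of_mem_parDomain hx)
    refine mem_biUnion hj ⟨x, ⟨?_, hxj⟩, rfl⟩
    by_contra hxN
    refine hzK ?_
    obtain ⟨B, hB, hxB⟩ := H.exists_mem_parMesh hx fun ℓ hℓ α k hk hne => hxN (by
      simp only [hN, mem_iUnion]
      exact ⟨ℓ, Finset.mem_range.2 (by omega), α, k, Finset.mem_range.2 hk, hne.symm⟩)
    exact mem_biUnion (mem_physMesh.2 ⟨B, hB, rfl⟩) ⟨x, hxB, rfl⟩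
  refine measure_mono_null hsub ((measure_biUnion_null_iff (Finset.countable_toSet _)).2 ?_)
  intro j hj
  exact volume_image_eq_zero (hw.extendsSmoothly_geoMap hj P)
    (measure_mono_null inter_subset_left hN0) inter_subset_right

theorem setIntegral_eq_sum_physMesh (hw : IsWeight (H.Ξ 0) w)
    (hΦ : IsRegularMap H (geoMap (H.Ξ 0) w P) Q) {f : SpT d → ℝ} (hf : IntegrableOn f Q) :
    ∫ z in Q, f z = ∑ K ∈ physMesh H (geoMap (H.Ξ 0) w P), ∫ z in K, f z := by
  have hae : Q =ᵐ[volume] ⋃ K ∈ physMesh H (geoMap (H.Ξ 0) w P), id K := by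
    refine ae_eq_set.2 ⟨volume_diff_physMesh hw hΦ, ?_⟩
    refine measure_mono_null (fun z hz => ?_) (measure_empty (μ := volume))
    obtain ⟨K, hK, hzK⟩ := mem_iUnion₂.1 hz.1
    exact hz.2 (subset_of_mem_physMesh hΦ hK hzK)
  rw [setIntegral_congr_set hae]
  exact integral_biUnion_finset _ (s := id)
    (fun K hK => (isOpen_of_mem_physMesh hw hΦ hK).measurableSet) (physMesh_pairwiseDisjoint hΦ)
    fun K hK => hf.mono_set (subset_of_mem_physMesh hΦ hK)

end PhysicalMesh

/-! ### Square-integrable functions -/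

section L2

variable {α : Type*} [MeasurableSpace α] {μ : Measure α} {f g : α → ℝ}

theorem inner_toLp (hf : MemLp f 2 μ) (hg : MemLp g 2 μ) :
    inner ℝ (hf.toLp f) (hg.toLp g) = ∫ z, f z * g z ∂μ := by
  rw [L2.inner_def]
  refine integral_congr_ae ?_
  filter_upwards [hf.coeFn_toLp, hg.coeFn_toLp] with z h1 h2
  rw [h1, h2]
  simp [mul_comm]

theorem norm_toLp_eq_sqrt (hf : MemLp f 2 μ) : ‖hf.toLp f‖ = √(∫ z, f z * f z ∂μ) := by
  rw [← inner_toLp hf hf, real_inner_self_eq_norm_sq, Real.sqrt_sq (norm_nonneg _)]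

theorem abs_integral_mul_le (hf : MemLp f 2 μ) (hg : MemLp g 2 μ) :
    |∫ z, f z * g z ∂μ| ≤ √(∫ z, f z * f z ∂μ) * √(∫ z, g z * g z ∂μ) := by
  rw [← inner_toLp hf hg, ← norm_toLp_eq_sqrt hf, ← norm_toLp_eq_sqrt hg]
  exact abs_real_inner_le_norm _ _

theorem tendsto_eLpNorm_zero_iff {ι : Type*} {l : Filter ι} {F : ι → α → ℝ}
    (hF : ∀ i, MemLp (F i) 2 μ) :
    Tendsto (fun i => eLpNorm (F i) 2 μ) l (𝓝 0) ↔
      Tendsto (fun i => ∫ z, F i z * F i z ∂μ) l (𝓝 0) := by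
  have e : ∀ i, eLpNorm (F i) 2 μ = ENNReal.ofReal √(∫ z, F i z * F i z ∂μ) := fun i => by
    rw [← norm_toLp_eq_sqrt (hF i), Lp.norm_toLp, ENNReal.ofReal_toReal (hF i).eLpNorm_ne_top]
  simp only [e]
  constructor
  · intro h
    have h1 := (ENNReal.tendsto_toReal ENNReal.zero_ne_top).comp h
    have h2 := h1.pow 2
    refine (h2.congr fun i => ?_).trans (by simp)
    rw [Function.comp, ENNReal.toReal_ofReal (Real.sqrt_nonneg _), Real.sq_sqrt]
    exact integral_nonneg fun z => mul_self_nonneg _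
  · intro h
    have := ENNReal.tendsto_ofReal (h.sqrt)
    simpa using this

theorem tendsto_integral_mul {ι : Type*} {l : Filter ι} {F G : ι → α → ℝ}
    (hF : ∀ i, MemLp (F i) 2 μ) (hG : ∀ i, MemLp (G i) 2 μ) (hf : MemLp f 2 μ) (hg : MemLp g 2 μ)
    (h : Tendsto (fun i => eLpNorm (fun z => F i z - f z) 2 μ) l (𝓝 0))
    (h' : Tendsto (fun i => eLpNorm (fun z => G i z - g z) 2 μ) l (𝓝 0)) :
    Tendsto (fun i => ∫ z, F i z * G i z ∂μ) l (𝓝 (∫ z, f z * g z ∂μ)) := by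
  rw [← inner_toLp hf hg]
  simp only [← inner_toLp (hF _) (hG _)]
  exact ((Lp.tendsto_Lp_iff_tendsto_eLpNorm'' F hF f hf).2 h).inner
    ((Lp.tendsto_Lp_iff_tendsto_eLpNorm'' G hG g hg).2 h')

theorem tendsto_eLpNorm_sub {ι : Type*} {l : Filter ι} {F G : ι → α → ℝ}
    (hF : ∀ i, MemLp (F i) 2 μ) (hG : ∀ i, MemLp (G i) 2 μ) (hf : MemLp f 2 μ)
    (h : Tendsto (fun i => eLpNorm (fun z => F i z - f z) 2 μ) l (𝓝 0))
    (h' : Tendsto (fun i => eLpNorm (fun z => G i z - f z) 2 μ) l (𝓝 0)) :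
    Tendsto (fun i => eLpNorm (fun z => F i z - G i z) 2 μ) l (𝓝 0) := by
  refine tendsto_of_tendsto_of_tendsto_of_le_of_le tendsto_const_nhds (by simpa using h.add h')
    (fun _ => zero_le) fun i => ?_
  have : (fun z => F i z - G i z) = (fun z => F i z - f z) - fun z => G i z - f z := by
    ext z
    simp
  rw [this]
  exact eLpNorm_sub_le ((hF i).sub hf).1 ((hG i).sub hf).1 (by norm_num)

end L2

/-! ### Traces in time -/

section TimeTrace

variable {d : ℕ} {Ω : Set (EuclideanSpace ℝ (Fin d))} {T : ℝ}

theorem isBounded_cyl (hb : Bornology.IsBounded Ω) (T : ℝ) : Bornology.IsBounded (cyl Ω T) :=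
  hb.prod (Metric.isBounded_Ioo 0 T)

theorem isOpen_cyl (hΩ : IsOpen Ω) (T : ℝ) : IsOpen (cyl Ω T) := hΩ.prod isOpen_Ioo

theorem hasDerivAt_time {χ : SpT d → ℝ} (hχ : ContDiff ℝ ∞ χ) (x : EuclideanSpace ℝ (Fin d))
    (t : ℝ) : HasDerivAt (fun t => χ (x, t)) (fderiv ℝ χ (x, t) et) t :=
  ((hχ.differentiable (by simp)).differentiableAt.hasFDerivAt).comp_hasDerivAt t
    ((hasDerivAt_const t x).prodMk (hasDerivAt_id t))

theorem continuous_fderiv_apply_const {χ : SpT d → ℝ} (hχ : ContDiff ℝ ∞ χ) (e : SpT d) :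
    Continuous fun z => fderiv ℝ χ z e :=
  (hχ.continuous_fderiv (by simp)).clm_apply continuous_const

theorem setIntegral_cyl (hb : Bornology.IsBounded Ω) {f : SpT d → ℝ} (hf : Continuous f) :
    ∫ z in cyl Ω T, f z = ∫ x in Ω, ∫ t in Ioo 0 T, f (x, t) :=
  setIntegral_prod f (integrableOn_of_continuous (isBounded_cyl hb T) hf)

theorem integrableOn_integral_time (hb : Bornology.IsBounded Ω) {f : SpT d → ℝ}
    (hf : Continuous f) : IntegrableOn (fun x => ∫ t in Ioo 0 T, f (x, t)) Ω := by
  have h : IntegrableOn f (cyl Ω T) := integrableOn_of_continuous (isBounded_cyl hb T) hf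
  have h' : Integrable f ((volume.restrict Ω).prod (volume.restrict (Ioo 0 T))) := by
    rw [Measure.prod_restrict]
    exact h
  exact h'.integral_prod_left

theorem setIntegral_time_eq_sub (hT : 0 < T) {f f' : ℝ → ℝ} (hf : ∀ t, HasDerivAt f (f' t) t)
    (hf' : Continuous f') : ∫ t in Ioo 0 T, f' t = f T - f 0 := by
  rw [← integral_Ioc_eq_integral_Ioo, ← intervalIntegral.integral_of_le hT.le]
  exact intervalIntegral.integral_eq_sub_of_hasDerivAt (fun t _ => hf t)
    (hf'.intervalIntegrable 0 T)

theorem sq_integral_le (hT : 0 < T) {h : ℝ → ℝ} (hh : Continuous h) :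
    (∫ t in Ioo 0 T, h t) ^ 2 ≤ T * ∫ t in Ioo 0 T, h t ^ 2 := by
  have hb := Metric.isBounded_Ioo (0 : ℝ) T
  have := abs_integral_mul_le (memLp_two_restrict_of_continuous (ν := volume) hb hh)
    (memLp_two_restrict_of_continuous (ν := volume) hb (continuous_const (y := (1 : ℝ))))
  simp only [mul_one, ← sq] at this
  have h1 : ∫ _ in Ioo 0 T, (1 : ℝ) ^ 2 = T := by simp [hT.le]
  rw [h1] at this
  have h2 := mul_self_le_mul_self (abs_nonneg _) this
  rw [abs_mul_abs_self, mul_mul_mul_comm, Real.mul_self_sqrt hT.le, Real.mul_self_sqrt] at h2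
  · linarith
  · exact integral_nonneg fun _ => sq_nonneg _

/-- The integrand `f + (t - a) f'` is the derivative of `(t - a) f`. The choices `a = 0` and `a = T`
isolate the values at `T` and at `0`. -/
theorem sq_endpoint_le (hT : 0 < T) {a : ℝ} (ha : a ∈ Icc 0 T) {f f' : ℝ → ℝ}
    (hf : ∀ t, HasDerivAt f (f' t) t) (hf' : Continuous f') :
    ((T - a) * f T + a * f 0) ^ 2 ≤ ∫ t in Ioo 0 T, 2 * T * (f t ^ 2 + T ^ 2 * f' t ^ 2) := by
  have hc : Continuous f := continuous_iff_continuousAt.2 fun t => (hf t).continuousAt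
  have hh : Continuous fun t => f t + (t - a) * f' t := by fun_prop
  have key : ∫ t in Ioo 0 T, (f t + (t - a) * f' t) = (T - a) * f T + a * f 0 := by
    rw [setIntegral_time_eq_sub hT (f := fun t => (t - a) * f t) _ hh]
    · ring
    · intro t
      exact (((hasDerivAt_id t).sub_const a).mul (hf t)).congr_deriv (by simp)
  rw [← key]
  refine (sq_integral_le hT hh).trans ?_
  rw [← integral_const_mul]
  have hb := Metric.isBounded_Ioo (0 : ℝ) T
  refine setIntegral_mono_on (integrableOn_of_continuous hb (by fun_prop))
    (integrableOn_of_continuous hb (by fun_prop)) measurableSet_Ioo fun t ht => ?_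
  have h1 : (t - a) ^ 2 ≤ T ^ 2 := by
    apply sq_le_sq' <;> linarith [ht.1, ht.2, ha.1, ha.2]
  have h2 : ((t - a) * f' t) ^ 2 ≤ T ^ 2 * f' t ^ 2 := by
    rw [mul_pow]
    gcongr
  rw [mul_comm 2 T, mul_assoc]
  refine mul_le_mul_of_nonneg_left ?_ hT.le
  nlinarith [sq_nonneg (f t - (t - a) * f' t)]

/-- The trace inequality for smooth functions. -/
theorem integral_endpoint_sq_le (hb : Bornology.IsBounded Ω) (hT : 0 < T) {s : ℝ}
    (hs : s = 0 ∨ s = T) {χ : SpT d → ℝ} (hχ : ContDiff ℝ ∞ χ) :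
    T ^ 2 * ∫ x in Ω, χ (x, s) * χ (x, s) ≤ 2 * T * ((∫ z in cyl Ω T, χ z * χ z) +
      T ^ 2 * ∫ z in cyl Ω T, fderiv ℝ χ z et * fderiv ℝ χ z et) := by
  have hc := hχ.continuous
  have hc' := continuous_fderiv_apply_const hχ et
  have hQ := isBounded_cyl hb T
  rw [← integral_const_mul, ← integral_const_mul (T ^ 2) (fun z : SpT d => _),
    ← integral_add (integrableOn_of_continuous hQ (f := fun z => χ z * χ z) (by fun_prop))
      (integrableOn_of_continuous hQ
        (f := fun z => T ^ 2 * (fderiv ℝ χ z et * fderiv ℝ χ z et)) (by fun_prop)),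
    ← integral_const_mul, setIntegral_cyl hb (by fun_prop)]
  refine integral_mono (integrableOn_of_continuous hb (by fun_prop))
    (integrableOn_integral_time hb (f := fun z => 2 * T * (χ z * χ z +
      T ^ 2 * (fderiv ℝ χ z et * fderiv ℝ χ z et))) (by fun_prop)) fun x => ?_
  have := sq_endpoint_le hT (a := T - s) (by rcases hs with rfl | rfl <;> simp [hT.le])
    (fun t => hasDerivAt_time hχ x t) (hc'.comp (Continuous.prodMk_right x))
  simp only [← sq] at this ⊢
  refine le_trans (le_of_eq ?_) this
  rcases hs with rfl | rfl <;> ring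

theorem tendsto_endpoint_zero (hb : Bornology.IsBounded Ω) (hT : 0 < T) {s : ℝ}
    (hs : s = 0 ∨ s = T) {ι : Type*} {l : Filter ι} {X : ι → SpT d → ℝ}
    (hX : ∀ i, ContDiff ℝ ∞ (X i))
    (h0 : Tendsto (fun i => eLpNorm (X i) 2 (volume.restrict (cyl Ω T))) l (𝓝 0))
    (h1 : Tendsto (fun i => eLpNorm (fun z => fderiv ℝ (X i) z et) 2 (volume.restrict (cyl Ω T))) l
      (𝓝 0)) :
    Tendsto (fun i => eLpNorm (fun x => X i (x, s)) 2 (volume.restrict Ω)) l (𝓝 0) := by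
  have hQ := isBounded_cyl hb T
  rw [tendsto_eLpNorm_zero_iff fun i => memLp_two_restrict_of_continuous hQ (hX i).continuous] at h0
  rw [tendsto_eLpNorm_zero_iff fun i =>
    memLp_two_restrict_of_continuous hQ (continuous_fderiv_apply_const (hX i) et)] at h1
  rw [tendsto_eLpNorm_zero_iff (F := fun i x => X i (x, s)) fun i =>
    memLp_two_restrict_of_continuous hb ((hX i).continuous.comp (Continuous.prodMk_left s))]
  have hlim := ((h0.add (h1.const_mul (T ^ 2))).const_mul (2 * T)).div_const (T ^ 2)
  simp only [mul_zero, add_zero, zero_div] at hlim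
  refine tendsto_of_tendsto_of_tendsto_of_le_of_le tendsto_const_nhds hlim
    (fun i => integral_nonneg fun x => mul_self_nonneg _) fun i => ?_
  rw [le_div_iff₀ (by positivity), mul_comm]
  exact integral_endpoint_sq_le hb hT hs (hX i)

theorem fderiv_sub_apply_const {φ ψ : SpT d → ℝ} (hφ : ContDiff ℝ ∞ φ) (hψ : ContDiff ℝ ∞ ψ)
    (z e : SpT d) : fderiv ℝ (fun z => φ z - ψ z) z e = fderiv ℝ φ z e - fderiv ℝ ψ z e := by
  rw [fderiv_fun_sub (hφ.differentiable (by simp)).differentiableAt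
    (hψ.differentiable (by simp)).differentiableAt]
  rfl

/-- `φ n → u` and `∂ₜ φ n → ∂ₜ u` in `L₂(Q)`, with `φ n` smooth. -/
def ApproxInTime (Ω : Set (EuclideanSpace ℝ (Fin d))) (T : ℝ) (u : SpT d → ℝ)
    (φ : ℕ → SpT d → ℝ) : Prop :=
  (∀ n, ContDiff ℝ ∞ (φ n)) ∧
    Tendsto (fun n => eLpNorm (fun z => φ n z - u z) 2 (volume.restrict (cyl Ω T))) atTop (𝓝 0) ∧
    Tendsto (fun n => eLpNorm (fun z => fderiv ℝ (φ n) z et - dt (cyl Ω T) u z) 2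
      (volume.restrict (cyl Ω T))) atTop (𝓝 0)

theorem hasTimeTrace_iff {s : ℝ} {u : SpT d → ℝ} {g : EuclideanSpace ℝ (Fin d) → ℝ} :
    HasTimeTrace Ω T s u g ↔ ∃ φ, ApproxInTime Ω T u φ ∧
      Tendsto (fun n => eLpNorm (fun x => φ n (x, s) - g x) 2 (volume.restrict Ω)) atTop (𝓝 0) := by
  simp only [HasTimeTrace, HasTrace, ApproxInTime, mem_singleton_iff, forall_eq, dt, and_assoc]

theorem HasTimeTrace.add_zero (hΩ : IsOpen Ω) (hb : Bornology.IsBounded Ω) {s : ℝ}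
    {u v : SpT d → ℝ} (hu : InL2 (cyl Ω T) u) (hu' : DerivInL2 (cyl Ω T) et u)
    (hu0 : HasTimeTrace Ω T s u 0) (hv : InL2 (cyl Ω T) v) (hv' : DerivInL2 (cyl Ω T) et v)
    (hv0 : HasTimeTrace Ω T s v 0) : HasTimeTrace Ω T s (u + v) 0 := by
  have hQ := isBounded_cyl hb T
  have hQo := isOpen_cyl hΩ T
  obtain ⟨φ, hφ, hφ0⟩ := hasTimeTrace_iff.1 hu0
  obtain ⟨ψ, hψ, hψ0⟩ := hasTimeTrace_iff.1 hv0
  have squeeze : ∀ {α : Type _} [MeasurableSpace α] {μ : Measure α} {F G : ℕ → α → ℝ},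
      (∀ n, AEStronglyMeasurable (F n) μ) → (∀ n, AEStronglyMeasurable (G n) μ) →
      Tendsto (fun n => eLpNorm (F n) 2 μ) atTop (𝓝 0) →
      Tendsto (fun n => eLpNorm (G n) 2 μ) atTop (𝓝 0) →
      Tendsto (fun n => eLpNorm (F n + G n) 2 μ) atTop (𝓝 0) := fun hF hG h h' =>
    tendsto_of_tendsto_of_tendsto_of_le_of_le tendsto_const_nhds (by simpa using h.add h')
      (fun _ => zero_le) fun n => eLpNorm_add_le (hF n) (hG n) (by norm_num)
  refine hasTimeTrace_iff.2 ⟨fun n z => φ n z + ψ n z, ⟨fun n => (hφ.1 n).add (hψ.1 n), ?_, ?_⟩, ?_⟩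
  · refine (squeeze (fun n => (hφ.1 n).continuous.aestronglyMeasurable.sub hu.1)
      (fun n => (hψ.1 n).continuous.aestronglyMeasurable.sub hv.1) hφ.2.1 hψ.2.1).congr fun n => ?_
    congr 1
    ext z
    simp
    ring
  · refine (squeeze
      (fun n => (continuous_fderiv_apply_const (hφ.1 n) et).aestronglyMeasurable.sub (hu'.inL2 hQo).1)
      (fun n => (continuous_fderiv_apply_const (hψ.1 n) et).aestronglyMeasurable.sub (hv'.inL2 hQo).1)
      hφ.2.2 hψ.2.2).congr fun n => ?_
    refine eLpNorm_congr_ae ?_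
    filter_upwards [hu'.weakDeriv_add hQo hv'] with z hz
    rw [dt, hz, fderiv_fun_add ((hφ.1 n).differentiable (by simp)).differentiableAt
      ((hψ.1 n).differentiable (by simp)).differentiableAt]
    simp
    ring
  · have hm : ∀ χ : SpT d → ℝ, ContDiff ℝ ∞ χ →
        AEStronglyMeasurable (fun x => χ (x, s) - (0 : EuclideanSpace ℝ (Fin d) → ℝ) x)
          (volume.restrict Ω) := fun χ hχ =>
      ((hχ.continuous.comp (Continuous.prodMk_left s)).sub continuous_const).aestronglyMeasurable
    refine (squeeze (fun n => hm _ (hφ.1 n)) (fun n => hm _ (hψ.1 n)) hφ0 hψ0).congr fun n => ?_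
    congr 1
    ext x
    simp

/-- The index maps let one statement serve twice: with the two projections of `ℕ × ℕ` it says that
the end values are Cauchy, with identities that the limit does not depend on the sequence. -/
theorem ApproxInTime.tendsto_endpoint_sub (hb : Bornology.IsBounded Ω) (hT : 0 < T) {s : ℝ}
    (hs : s = 0 ∨ s = T) {u : SpT d → ℝ} (hu : InL2 (cyl Ω T) u)
    (hu' : InL2 (cyl Ω T) (dt (cyl Ω T) u)) {φ ψ : ℕ → SpT d → ℝ} (hφ : ApproxInTime Ω T u φ)
    (hψ : ApproxInTime Ω T u ψ) {ι : Type*} {l : Filter ι} {a b : ι → ℕ}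
    (ha : Tendsto a l atTop) (hb' : Tendsto b l atTop) :
    Tendsto (fun i => eLpNorm (fun x => φ (a i) (x, s) - ψ (b i) (x, s)) 2 (volume.restrict Ω)) l
      (𝓝 0) := by
  have hQ := isBounded_cyl hb T
  refine tendsto_endpoint_zero hb hT hs (X := fun i z => φ (a i) z - ψ (b i) z)
    (fun i => (hφ.1 _).sub (hψ.1 _)) ?_ ?_
  · exact tendsto_eLpNorm_sub
      (fun i => memLp_two_restrict_of_continuous hQ (hφ.1 (a i)).continuous)
      (fun i => memLp_two_restrict_of_continuous hQ (hψ.1 (b i)).continuous) hu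
      (hφ.2.1.comp ha) (hψ.2.1.comp hb')
  · simp only [fderiv_sub_apply_const (hφ.1 _) (hψ.1 _)]
    exact tendsto_eLpNorm_sub
      (fun i => memLp_two_restrict_of_continuous hQ (continuous_fderiv_apply_const (hφ.1 (a i)) et))
      (fun i => memLp_two_restrict_of_continuous hQ (continuous_fderiv_apply_const (hψ.1 (b i)) et)) hu'
      (hφ.2.2.comp ha) (hψ.2.2.comp hb')

/-- The trace at the final time exists. -/
theorem ApproxInTime.exists_trace (hb : Bornology.IsBounded Ω) (hT : 0 < T) {u : SpT d → ℝ}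
    (hu : InL2 (cyl Ω T) u) (hu' : InL2 (cyl Ω T) (dt (cyl Ω T) u)) {φ : ℕ → SpT d → ℝ}
    (hφ : ApproxInTime Ω T u φ) :
    ∃ g, MemLp g 2 (volume.restrict Ω) ∧ HasTimeTrace Ω T T u g := by
  have hL : ∀ n, MemLp (fun x => φ n (x, T)) 2 (volume.restrict Ω) := fun n =>
    memLp_two_restrict_of_continuous hb ((hφ.1 n).continuous.comp (Continuous.prodMk_left T))
  have hC : CauchySeq fun n => (hL n).toLp _ := by
    rw [cauchySeq_iff_tendsto_dist_atTop_0]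
    have h := hφ.tendsto_endpoint_sub hb hT (Or.inr rfl) hu hu' hφ
      (l := (atTop : Filter (ℕ × ℕ))) (a := Prod.fst) (b := Prod.snd)
      (by rw [← prod_atTop_atTop_eq]; exact tendsto_fst)
      (by rw [← prod_atTop_atTop_eq]; exact tendsto_snd)
    refine ((ENNReal.tendsto_toReal ENNReal.zero_ne_top).comp h).congr fun i => ?_
    rw [dist_eq_norm, ← MemLp.toLp_sub, Lp.norm_toLp]
    rfl
  obtain ⟨g, hg⟩ := cauchySeq_tendsto_of_complete hC
  refine ⟨g, Lp.memLp g, hasTimeTrace_iff.2 ⟨φ, hφ, ?_⟩⟩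
  refine (Lp.tendsto_Lp_iff_tendsto_eLpNorm'' _ hL g (Lp.memLp g)).1 ?_
  rwa [Lp.toLp_coeFn]

/-- `traceT` is a chosen trace that comes with its own approximating sequence; independence of the
sequence makes it the limit for any other. -/
theorem ApproxInTime.tendsto_traceT (hb : Bornology.IsBounded Ω) (hT : 0 < T) {u : SpT d → ℝ}
    (hu : InL2 (cyl Ω T) u) (hu' : InL2 (cyl Ω T) (dt (cyl Ω T) u)) {φ : ℕ → SpT d → ℝ}
    (hφ : ApproxInTime Ω T u φ) :
    MemLp (traceT Ω T u) 2 (volume.restrict Ω) ∧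
      Tendsto (fun n => eLpNorm (fun x => φ n (x, T) - traceT Ω T u x) 2 (volume.restrict Ω)) atTop
        (𝓝 0) := by
  have hex := hφ.exists_trace hb hT hu hu'
  rw [traceT, dif_pos hex]
  obtain ⟨hg, hgt⟩ := hex.choose_spec
  refine ⟨hg, ?_⟩
  obtain ⟨ψ, hψ, hlim⟩ := hasTimeTrace_iff.1 hgt
  have h := hφ.tendsto_endpoint_sub hb hT (Or.inr rfl) hu hu' hψ tendsto_id tendsto_id
  refine tendsto_of_tendsto_of_tendsto_of_le_of_le tendsto_const_nhds (by simpa using h.add hlim)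
    (fun _ => zero_le) fun n => ?_
  have hm : ∀ χ : SpT d → ℝ, ContDiff ℝ ∞ χ →
      AEStronglyMeasurable (fun x => χ (x, T)) (volume.restrict Ω) := fun χ hχ =>
    (hχ.continuous.comp (Continuous.prodMk_left T)).aestronglyMeasurable
  have e : (fun x => φ n (x, T) - hex.choose x) =
      (fun x => φ n (x, T) - ψ n (x, T)) + fun x => ψ n (x, T) - hex.choose x := by
    ext x
    simp
  show eLpNorm (fun x => φ n (x, T) - hex.choose x) 2 (volume.restrict Ω) ≤ _
  rw [e]
  exact eLpNorm_add_le ((hm _ (hφ.1 n)).sub (hm _ (hψ.1 n))) ((hm _ (hψ.1 n)).sub hg.1)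
    (by norm_num)

theorem integral_by_parts_time_of_contDiff (hb : Bornology.IsBounded Ω) (hT : 0 < T)
    {φ ψ : SpT d → ℝ} (hφ : ContDiff ℝ ∞ φ) (hψ : ContDiff ℝ ∞ ψ) :
    (∫ z in cyl Ω T, fderiv ℝ φ z et * ψ z) + ∫ z in cyl Ω T, φ z * fderiv ℝ ψ z et =
      (∫ x in Ω, φ (x, T) * ψ (x, T)) - ∫ x in Ω, φ (x, 0) * ψ (x, 0) := by
  have hQ := isBounded_cyl hb T
  have c1 := hφ.continuous
  have c2 := hψ.continuous
  have c3 := continuous_fderiv_apply_const hφ et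
  have c4 := continuous_fderiv_apply_const hψ et
  rw [← integral_add
    (integrableOn_of_continuous hQ (f := fun z => fderiv ℝ φ z et * ψ z) (by fun_prop))
    (integrableOn_of_continuous hQ (f := fun z => φ z * fderiv ℝ ψ z et) (by fun_prop)), ← integral_sub
    (integrableOn_of_continuous hb (by fun_prop)) (integrableOn_of_continuous hb (by fun_prop)),
    setIntegral_cyl hb (by fun_prop)]
  refine integral_congr_ae (Eventually.of_forall fun x => ?_)
  exact setIntegral_time_eq_sub hT (f := fun t => φ (x, t) * ψ (x, t))
    (fun t => (hasDerivAt_time hφ x t).mul (hasDerivAt_time hψ x t)) (by fun_prop)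

/-- Integration by parts in time for functions that vanish at the initial time. -/
theorem integral_by_parts_time (hb : Bornology.IsBounded Ω) (hT : 0 < T) {u v : SpT d → ℝ}
    (hu : InL2 (cyl Ω T) u) (hu' : InL2 (cyl Ω T) (dt (cyl Ω T) u))
    (hu0 : HasTimeTrace Ω T 0 u 0) (hv : InL2 (cyl Ω T) v)
    (hv' : InL2 (cyl Ω T) (dt (cyl Ω T) v)) (hv0 : HasTimeTrace Ω T 0 v 0) :
    MemLp (traceT Ω T u) 2 (volume.restrict Ω) ∧ MemLp (traceT Ω T v) 2 (volume.restrict Ω) ∧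
      ip (cyl Ω T) (dt (cyl Ω T) u) v + ip (cyl Ω T) u (dt (cyl Ω T) v) =
        ∫ x in Ω, traceT Ω T u x * traceT Ω T v x := by
  have hQ := isBounded_cyl hb T
  -- The sequence witnessing the zero initial trace also converges at the final time, so a single
  -- sequence controls both ends.
  obtain ⟨φ, hφ, hφ0⟩ := hasTimeTrace_iff.1 hu0
  obtain ⟨ψ, hψ, hψ0⟩ := hasTimeTrace_iff.1 hv0
  obtain ⟨hgu, hφT⟩ := hφ.tendsto_traceT hb hT hu hu'
  obtain ⟨hgv, hψT⟩ := hψ.tendsto_traceT hb hT hv hv'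
  refine ⟨hgu, hgv, ?_⟩
  have mQ : ∀ {χ : ℕ → SpT d → ℝ}, (∀ n, ContDiff ℝ ∞ (χ n)) → ∀ n,
      MemLp (χ n) 2 (volume.restrict (cyl Ω T)) := fun h n =>
    memLp_two_restrict_of_continuous hQ (h n).continuous
  have mQ' : ∀ {χ : ℕ → SpT d → ℝ}, (∀ n, ContDiff ℝ ∞ (χ n)) → ∀ n,
      MemLp (fun z => fderiv ℝ (χ n) z et) 2 (volume.restrict (cyl Ω T)) := fun h n =>
    memLp_two_restrict_of_continuous hQ (continuous_fderiv_apply_const (h n) et)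
  have mΩ : ∀ {χ : ℕ → SpT d → ℝ} (s : ℝ), (∀ n, ContDiff ℝ ∞ (χ n)) → ∀ n,
      MemLp (fun x => χ n (x, s)) 2 (volume.restrict Ω) := fun s h n =>
    memLp_two_restrict_of_continuous hb ((h n).continuous.comp (Continuous.prodMk_left s))
  have t1 := tendsto_integral_mul (mQ' hφ.1) (mQ hψ.1) hu' hv hφ.2.2 hψ.2.1
  have t2 := tendsto_integral_mul (mQ hφ.1) (mQ' hψ.1) hu hv' hφ.2.1 hψ.2.2
  have t3 := tendsto_integral_mul (mΩ T hφ.1) (mΩ T hψ.1) hgu hgv hφT hψT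
  have t4 := tendsto_integral_mul (mΩ 0 hφ.1) (mΩ 0 hψ.1) MemLp.zero MemLp.zero hφ0 hψ0
  have h := tendsto_nhds_unique
    ((t1.add t2).congr fun n => integral_by_parts_time_of_contDiff hb hT (hφ.1 n) (hψ.1 n))
    (t3.sub t4)
  simpa [ip] using h

end TimeTrace

/-! ### Boundedness of the bilinear form -/

section Boundedness

variable {d : ℕ} {U : Set (SpT d)}

theorem ip_self_nonneg (U : Set (SpT d)) (f : SpT d → ℝ) : 0 ≤ ip U f f :=
  integral_nonneg fun _ => mul_self_nonneg _

theorem ipv_self_nonneg (U : Set (SpT d)) (y : Fin d → SpT d → ℝ) : 0 ≤ ipv U y y :=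
  integral_nonneg fun _ => Finset.sum_nonneg fun _ _ => mul_self_nonneg _

theorem abs_ip_le {f g : SpT d → ℝ} (hf : InL2 U f) (hg : InL2 U g) :
    |ip U f g| ≤ √(ip U f f) * √(ip U g g) :=
  abs_integral_mul_le hf hg

theorem ipv_eq_sum {y q : Fin d → SpT d → ℝ} (hy : ∀ i, InL2 U (y i)) (hq : ∀ i, InL2 U (q i)) :
    ipv U y q = ∑ i, ip U (y i) (q i) :=
  integral_finsetSum Finset.univ (f := fun i z => y i z * q i z) fun i _ =>
    (hy i).integrable_mul (hq i)

theorem abs_ipv_le {y q : Fin d → SpT d → ℝ} (hy : ∀ i, InL2 U (y i)) (hq : ∀ i, InL2 U (q i)) :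
    |ipv U y q| ≤ √(ipv U y y) * √(ipv U q q) := by
  rw [ipv_eq_sum hy hq, ipv_eq_sum hy hy, ipv_eq_sum hq hq]
  exact (Finset.abs_sum_le_sum_abs _ _).trans ((Finset.sum_le_sum fun i _ =>
    abs_ip_le (hy i) (hq i)).trans (Real.sum_sqrt_mul_sqrt_le _ (fun _ => ip_self_nonneg _ _)
      fun _ => ip_self_nonneg _ _))

theorem sqrt_mul_sqrt_add_le {a b c e : ℝ} (ha : 0 ≤ a) (hb : 0 ≤ b) (hc : 0 ≤ c) (he : 0 ≤ e) :
    √a * √b + √c * √e ≤ √(a + c) * √(b + e) := by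
  have := Real.sum_sqrt_mul_sqrt_le (Finset.univ : Finset (Fin 2)) (f := ![a, c]) (g := ![b, e])
    (by simp [Fin.forall_fin_two, ha, hc]) (by simp [Fin.forall_fin_two, hb, he])
  simpa [Fin.sum_univ_two] using this

/-- The Cauchy-Schwarz inequality that collects the bounds of the terms of the bilinear form. -/
theorem sum_bounds_le {ι : Type*} (s : Finset ι) {δ a m l b : ι → ℝ} {gu gv tu tv : ℝ}
    (hδ : ∀ i ∈ s, 0 < δ i) (hgu : 0 ≤ gu) (hgv : 0 ≤ gv) (htu : 0 ≤ tu) (htv : 0 ≤ tv)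
    (ha : ∀ i, 0 ≤ a i) (hm : ∀ i, 0 ≤ m i) (hl : ∀ i, 0 ≤ l i) (hb : ∀ i, 0 ≤ b i) :
    √tu * √tv + √gu * √gv + ∑ i ∈ s, (√(m i) * √(b i) + δ i * (√(a i) * √(b i) + √(l i) * √(b i)))
      ≤ 3 * √(gu + 1 / 2 * tu + ∑ i ∈ s, δ i * a i + ∑ i ∈ s, ((δ i)⁻¹ * m i + δ i * l i)) *
        √(gv + 1 / 2 * tv + ∑ i ∈ s, δ i * b i) := by
  classical
  -- In the application `g` and `t` are the squared norms of gradient and final trace, and `a`, `m`,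
  -- `l`, `b` those of `∂ₜu`, `u`, `Δₓu`, `∂ₜv` on an element.
  have hsum : ∑ i ∈ s, (√(m i) * √(b i) + δ i * (√(a i) * √(b i) + √(l i) * √(b i))) ≤
      √(∑ i ∈ s, (δ i * a i + ((δ i)⁻¹ * m i + δ i * l i))) * √(∑ i ∈ s, 3 * (δ i * b i)) := by
    -- The sum inequality asks for nonnegative terms at every index, but `δ` is positive only on
    -- `s`; hence the truncation by `if`.
    refine le_trans (Finset.sum_le_sum (g := fun i =>
      √(if i ∈ s then δ i * a i + ((δ i)⁻¹ * m i + δ i * l i) else 0) *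
        √(if i ∈ s then 3 * (δ i * b i) else 0)) fun i hi => ?_)
      (le_trans (Real.sum_sqrt_mul_sqrt_le s (fun i => ?_) fun i => ?_) (le_of_eq ?_))
    · have h := hδ i hi
      have h1 := ha i
      have h2 := hm i
      have h3 := hl i
      have h4 := hb i
      simp only [if_pos hi]
      rw [← Real.sqrt_mul (x := δ i * a i + ((δ i)⁻¹ * m i + δ i * l i)) (by positivity)]
      apply Real.le_sqrt_of_sq_le
      set x := √(m i) * √(b i) with hx
      set y := √(a i) * √(b i) with hy
      set z := √(l i) * √(b i) with hz
      have ex2 : x ^ 2 = m i * b i := by rw [hx, mul_pow, Real.sq_sqrt h2, Real.sq_sqrt h4]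
      have ey2 : y ^ 2 = a i * b i := by rw [hy, mul_pow, Real.sq_sqrt h1, Real.sq_sqrt h4]
      have ez2 : z ^ 2 = l i * b i := by rw [hz, mul_pow, Real.sq_sqrt h3, Real.sq_sqrt h4]
      -- The weights `δ⁻¹` and `δ` cancel in the product of `m` and `b`. The factor `3` is that of
      -- `(x + y + z)² ≤ 3 (x² + y² + z²)`.
      have e : (δ i * a i + ((δ i)⁻¹ * m i + δ i * l i)) * (3 * (δ i * b i)) =
          3 * (x ^ 2 + (δ i * y) ^ 2 + (δ i * z) ^ 2) := by
        rw [mul_pow _ y, mul_pow _ z, ex2, ey2, ez2]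
        field_simp
        ring
      rw [e]
      nlinarith [sq_nonneg (x - δ i * y), sq_nonneg (x - δ i * z), sq_nonneg (δ i * y - δ i * z)]
    · split_ifs with hi
      · have h := hδ i hi
        have h1 := ha i
        have h2 := hm i
        have h3 := hl i
        positivity
      · exact le_rfl
    · split_ifs with hi
      · have h := hδ i hi
        have h4 := hb i
        positivity
      · exact le_rfl
    · congr 2 <;> exact Finset.sum_congr rfl fun i hi => if_pos hi
  have hA : 0 ≤ ∑ i ∈ s, (δ i * a i + ((δ i)⁻¹ * m i + δ i * l i)) :=
    Finset.sum_nonneg fun i hi => by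
      have h := hδ i hi
      have h1 := ha i
      have h2 := hm i
      have h3 := hl i
      positivity
  have hB : 0 ≤ ∑ i ∈ s, δ i * b i := Finset.sum_nonneg fun i hi =>
    mul_nonneg (hδ i hi).le (hb i)
  rw [← Finset.mul_sum] at hsum
  rw [add_assoc (gu + _), ← Finset.sum_add_distrib]
  set A := ∑ i ∈ s, (δ i * a i + ((δ i)⁻¹ * m i + δ i * l i))
  set B := ∑ i ∈ s, δ i * b i
  have h1 := sqrt_mul_sqrt_add_le htu htv hgu hgv
  have h2 := sqrt_mul_sqrt_add_le (add_nonneg htu hgu) (add_nonneg htv hgv) hA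
    (mul_nonneg zero_le_three hB)
  -- The factor `2` compensates the weight `1/2` of the trace of `u`; on the side of `v` the factor
  -- `3` already covers it.
  have h3 : √(tu + gu + A) * √(tv + gv + 3 * B) ≤
      √(2 * (gu + 1 / 2 * tu + A)) * √(3 * (gv + 1 / 2 * tv + B)) :=
    mul_le_mul (Real.sqrt_le_sqrt (by linarith)) (Real.sqrt_le_sqrt (by linarith))
      (Real.sqrt_nonneg _) (Real.sqrt_nonneg _)
  rw [Real.sqrt_mul zero_le_two, Real.sqrt_mul zero_le_three] at h3
  have h4 : √(2 : ℝ) * √3 ≤ 3 := by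
    rw [← Real.sqrt_mul zero_le_two, Real.sqrt_le_left (by norm_num)]
    norm_num
  have h5 := mul_le_mul_of_nonneg_right h4
    (mul_nonneg (Real.sqrt_nonneg (gu + 1 / 2 * tu + A)) (Real.sqrt_nonneg (gv + 1 / 2 * tv + B)))
  nlinarith

variable {Ω : Set (EuclideanSpace ℝ (Fin d))} {T : ℝ}

/-- Boundedness with constant `3` on every finite family of open sets that decomposes integrals over
the cylinder, for functions with the regularity needed for Green's formula on each of them. -/
theorem abs_aloc_le (hΩ : IsOpen Ω) (hb : Bornology.IsBounded Ω) (hT : 0 < T)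
    {mesh : Finset (Set (SpT d))} {δ : Set (SpT d) → ℝ} (hδ : ∀ K ∈ mesh, 0 < δ K)
    (hopen : ∀ K ∈ mesh, IsOpen K) (hsub : ∀ K ∈ mesh, K ⊆ cyl Ω T)
    (hsum : ∀ f : SpT d → ℝ, IntegrableOn f (cyl Ω T) →
      ∫ z in cyl Ω T, f z = ∑ K ∈ mesh, ∫ z in K, f z)
    {u v : SpT d → ℝ} (hu : InL2 (cyl Ω T) u)
    (hux : ∀ i : Fin d, DerivInL2 (cyl Ω T) (ex i) u) (hut : DerivInL2 (cyl Ω T) et u)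
    (hu0 : HasTimeTrace Ω T 0 u 0) (hv : InL2 (cyl Ω T) v)
    (hvx : ∀ i : Fin d, DerivInL2 (cyl Ω T) (ex i) v) (hvt : DerivInL2 (cyl Ω T) et v)
    (hv0 : HasTimeTrace Ω T 0 v 0) (hdiv : ∀ K ∈ mesh, InHdivx K (gradx K u))
    (hH1 : ∀ K ∈ mesh, InH1 K (dt K v)) :
    |aloc Ω T mesh δ u v| ≤ 3 * normLocStar Ω T mesh δ u * normLoc Ω T mesh δ v := by
  have hQ := isOpen_cyl hΩ T
  obtain ⟨hgu, hgv, hparts⟩ :=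
    integral_by_parts_time hb hT hu (hut.inL2 hQ) hu0 hv (hvt.inL2 hQ) hv0
  have hsplit : ip (cyl Ω T) u (dt (cyl Ω T) v) = ∑ K ∈ mesh, ip K u (dt K v) := by
    refine (hsum _ (hu.integrable_mul (hvt.inL2 hQ))).trans (Finset.sum_congr rfl fun K hK => ?_)
    refine integral_congr_ae ?_
    filter_upwards [hvt.weakDeriv_restrict (hopen K hK) (hsub K hK)] with z hz
    simp only [dt, hz, Pi.mul_apply]
  -- After Green's formula and integration by parts in time, no second derivative of `v` is left.
  have hform : aloc Ω T mesh δ u v = (∫ x in Ω, traceT Ω T u x * traceT Ω T v x) +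
      ipv (cyl Ω T) (gradx (cyl Ω T) u) (gradx (cyl Ω T) v) +
      ∑ K ∈ mesh, (δ K * (ip K (dt K u) (dt K v) - ip K (lapx K u) (dt K v)) -
        ip K u (dt K v)) := by
    rw [Finset.sum_sub_distrib, ← hsplit, ← hparts, aloc]
    have : ∀ K ∈ mesh, δ K * (ip K (dt K u) (dt K v) + ipv K (gradx K u) (gradx K (dt K v)) -
        normalPairing K (gradx K u) (dt K v)) =
        δ K * (ip K (dt K u) (dt K v) - ip K (lapx K u) (dt K v)) := fun K hK => by
      rw [normalPairing, if_pos ⟨hdiv K hK, hH1 K hK⟩, lapx]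
      ring
    rw [Finset.sum_congr rfl this]
    ring
  have hnv : normLoc Ω T mesh δ v = √(ipv (cyl Ω T) (gradx (cyl Ω T) v) (gradx (cyl Ω T) v) +
      1 / 2 * (∫ x in Ω, traceT Ω T v x * traceT Ω T v x) +
      ∑ K ∈ mesh, δ K * ip K (dt K v) (dt K v)) := by
    simp only [normLoc, sq]
  have hnu : normLocStar Ω T mesh δ u =
      √(ipv (cyl Ω T) (gradx (cyl Ω T) u) (gradx (cyl Ω T) u) +
      1 / 2 * (∫ x in Ω, traceT Ω T u x * traceT Ω T u x) +
      ∑ K ∈ mesh, δ K * ip K (dt K u) (dt K u) +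
      ∑ K ∈ mesh, ((δ K)⁻¹ * ip K u u + δ K * ip K (lapx K u) (lapx K u))) := by
    rw [normLocStar, normLoc, Real.sq_sqrt]
    · simp only [sq]
    · refine add_nonneg (add_nonneg (ipv_self_nonneg _ _) (mul_nonneg (by norm_num)
        (integral_nonneg fun _ => sq_nonneg _))) (Finset.sum_nonneg fun K hK =>
        mul_nonneg (hδ K hK).le (ip_self_nonneg _ _))
  rw [hform, hnu, hnv]
  refine le_trans ?_ (sum_bounds_le mesh hδ (ipv_self_nonneg _ _) (ipv_self_nonneg _ _)
    (integral_nonneg fun _ => mul_self_nonneg _) (integral_nonneg fun _ => mul_self_nonneg _)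
    (fun K => ip_self_nonneg K (dt K u)) (fun K => ip_self_nonneg K u)
    (fun K => ip_self_nonneg K (lapx K u)) fun K => ip_self_nonneg K (dt K v))
  refine (abs_add_le _ _).trans (add_le_add ((abs_add_le _ _).trans (add_le_add
    (abs_integral_mul_le hgu hgv) (abs_ipv_le (fun i => (hux i).inL2 hQ)
      fun i => (hvx i).inL2 hQ))) ((Finset.abs_sum_le_sum_abs _ _).trans
        (Finset.sum_le_sum fun K hK => ?_)))
  have hKo := hopen K hK
  have hutK := (hut.mono (hsub K hK)).inL2 hKo
  have hvtK := (hvt.mono (hsub K hK)).inL2 hKo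
  have h1 := abs_ip_le hutK hvtK
  have h2 := abs_ip_le ((hdiv K hK).weakDivx_inL2 hKo) hvtK
  have h3 := abs_ip_le (hu.mono (hsub K hK)) hvtK
  refine (abs_sub _ _).trans ?_
  rw [add_comm, abs_mul, abs_of_pos (hδ K hK)]
  exact add_le_add h3 (mul_le_mul_of_nonneg_left ((abs_sub _ _).trans (add_le_add h1 h2))
    (hδ K hK).le)

/-- The smooth part has a Laplacian on all of `Q`, the discrete part only element by element; their
sum therefore has one on each element. -/
theorem InHdivx.gradx_add {K Q : Set (SpT d)} (hK : IsOpen K) (hKQ : K ⊆ Q) {w v : SpT d → ℝ}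
    (hw : ∀ i : Fin d, DerivInL2 Q (ex i) w)
    (hwdiv : ∃ g, HasWeakDivx Q (gradx Q w) g ∧ InL2 Q g)
    (hv : ∀ i : Fin d, DerivInL2 Q (ex i) v) (hvdiv : InHdivx K (gradx K v)) :
    InHdivx K (gradx K (w + v)) := by
  obtain ⟨g, hg, hgL⟩ := hwdiv
  obtain ⟨-, g', hg', hgL'⟩ := hvdiv
  refine ⟨fun i => (((hw i).add (hv i)).mono hKQ).inL2 hK, g + g',
    ((hg.mono hKQ).add hg').congr fun i => ?_, MemLp.add (hgL.mono hKQ) hgL'⟩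
  filter_upwards [(hw i).weakDeriv_restrict hK hKQ,
    ((hw i).mono hKQ).weakDeriv_add hK ((hv i).mono hKQ)] with z h1 h2
  simp only [gradx, Pi.add_apply, h2, h1]

end Boundedness

end SpaceTimeIgA

theorem mainTheorem3 (d p : ℕ) (hd : 1 ≤ d) (hd' : d ≤ 3) (hp : 2 ≤ p)
    (Ω : Set (EuclideanSpace ℝ (Fin d))) (hΩ : IsLipschitzDomain Ω) (T : ℝ) (hT : 0 < T)
    (H : Hierarchy d p)
    (w κ : (Fin (d + 1) → ℕ) → ℝ) (hw : IsWeight (H.Ξ 0) w) (hκ : IsWeight (H.Ξ 0) κ)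
    (P : (Fin (d + 1) → ℕ) → SpT d)
    (hΦ : IsRegularMap H (geoMap (H.Ξ 0) w P) (cyl Ω T))
    (C θ : Set (SpT d) → ℝ)
    (hC : ∀ K ∈ physMesh H (geoMap (H.Ξ 0) w P),
      IsInverseConst (Vh H κ (geoMap (H.Ξ 0) w P)) K (C K))
    (hθ : ∀ K ∈ physMesh H (geoMap (H.Ξ 0) w P),
      0 < θ K ∧ θ K ≤ hdiam K / (d * C K ^ 2)) :
    ∀ u ∈ V0hStar Ω T (Vh H κ (geoMap (H.Ξ 0) w P)),
      ∀ v ∈ V0h Ω T (Vh H κ (geoMap (H.Ξ 0) w P)),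
        |aloc Ω T (physMesh H (geoMap (H.Ξ 0) w P)) (fun K => θ K * hdiam K) u v| ≤
          3 * normLocStar Ω T (physMesh H (geoMap (H.Ξ 0) w P)) (fun K => θ K * hdiam K) u *
            normLoc Ω T (physMesh H (geoMap (H.Ξ 0) w P)) (fun K => θ K * hdiam K) v := by
  rintro u ⟨f, ⟨⟨⟨hf, hfx, -⟩, hft, hf0⟩, ⟨-, hfdiv, -⟩, -⟩, g, ⟨hgV, ⟨hg, hgx, -⟩, hgt, hg0⟩, rfl⟩
    v ⟨hvV, ⟨hv, hvx, -⟩, hvt, hv0⟩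
  have hopen : ∀ K ∈ physMesh H (geoMap (H.Ξ 0) w P), IsOpen K := fun K hK =>
    isOpen_of_mem_physMesh hw hΦ hK
  have hsub : ∀ K ∈ physMesh H (geoMap (H.Ξ 0) w P), K ⊆ cyl Ω T := fun K hK =>
    subset_of_mem_physMesh hΦ hK
  have hb := hΩ.2.2.1
  have hreg : ∀ K ∈ physMesh H (geoMap (H.Ξ 0) w P),
      ∀ v ∈ Vh H κ (geoMap (H.Ξ 0) w P), InHdivx K (gradx K v) ∧ InH1 K (dt K v) := by
    intro K hK v hv
    obtain ⟨F, hF, he⟩ := extendsSmoothly_of_mem_Vh hκ hΦ hK hv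
    exact inHdivx_inH1_of_contDiff hd (hopen K hK) ((isBounded_cyl hb T).subset (hsub K hK)) hF he
  refine abs_aloc_le hΩ.1 hb hT (fun K hK => ?_) hopen hsub
    (fun f hf => setIntegral_eq_sum_physMesh hw hΦ hf) (MemLp.add hf hg)
    (fun i => (hfx i).add (hgx i)) (hft.add hgt) (hf0.add_zero hΩ.1 hb hf hft hg hgt hg0) hv hvx hvt
    hv0 (fun K hK => InHdivx.gradx_add (hopen K hK) (hsub K hK) hfx hfdiv hgx (hreg K hK g hgV).1)
    fun K hK => (hreg K hK v hvV).2
  obtain ⟨hθ0, hθ1⟩ := hθ K hK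
  have hden : 0 ≤ (d : ℝ) * C K ^ 2 := by positivity
  -- The upper bound for `θ K` must exceed a positive number, which rules out a zero diameter and
  -- makes `δ_K` positive.
  have hdiam : 0 < hdiam K := by
    by_contra h
    exact absurd (hθ0.trans_le hθ1) (not_lt.2 (div_nonpos_of_nonpos_of_nonneg (not_lt.1 h) hden))
  exact mul_pos hθ0 hdiam
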